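/- Let $k$ be an arbitrary field and let $\mathcal A=\{a_1,\ldots,a_n\}\subset\mathbb N^m$ be a set of $n>m$ distinct nonzero vectors such that, for some integer $d\ge 1$, $\mathcal A$ contains $d e_1,\ldots,d e_m$ (where $e_1,\ldots,e_m$ is the canonical basis of $\mathbb Z^m$) and the coordinates of every $a_i$ sum to $d$. Let $I_{\mathcal A}\subset k[x_1,\ldots,x_n]$ be the toric ideal of $\mathcal A$ (a simplicial projective toric ideal), that is, the kernel of the $k$-algebra homomorphism $k[x_1,\ldots,x_n]\to k[t_1,\ldots,t_m]$, $x_i\mapsto t^{a_i}=t_1^{a_{i1}}\cdots t_m^{a_{im}}$. Call $I_{\mathcal A}$ a complete intersection if its minimal number of generators equals its height. The Reduction Algorithm computes a finite set $\mathcal A_{red}\subset\mathbb N^m$ from $\mathcal A$ as follows. Start with $\mathcal A_{red}:=\mathcal A$. Repeat the following pass until, at the end of a pass, $\mathcal A_{red}=\emptyset$ or $\mathcal A_{red}=G$; then return $\mathcal A_{red}$. Pass: set $G:=\mathcal A_{red}$; for each $a\in G$, one after another in any order, replace $\mathcal A_{red}$ by $\mathcal A_{red}\setminus\{a\}$, and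 then, if $a\in\mathbb Q\,\mathcal A_{red}$, put $B:=\min\{b\in\mathbb Z^+ \mid b\,a\in\mathbb Z\,\mathcal A_{red}\}$ and, if $B\,a\notin\mathbb N\,\mathcal A_{red}$, replace $\mathcal A_{red}$ by $\mathcal A_{red}\cup\{B\,a\}$. (Here $\mathbb Q S$, $\mathbb Z S$, $\mathbb N S$ denote the sets of finite linear combinations of elements of $S$ with coefficients in $\mathbb Q$, $\mathbb Z$, $\mathbb N$.) Then the algorithm terminates on input $\mathcal A$ and, whatever orders are chosen in its passes, $$I_{\mathcal A}\text{ is a complete intersection}\iff \mathcal A_{red}=\emptyset .$$ -/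

import Mathlib

namespace ToricReduction

variable {m : ℕ}

/-- The toric ideal of a finite set `A ⊂ ℕ^m` over `k`: the kernel of the `k`-algebra homomorphism
`k[x_a : a ∈ A] → k[t_1, …, t_m]`, `x_a ↦ t^a = t_1^{a_1} ⋯ t_m^{a_m}`. There is one variable for
each element of `A`. -/
noncomputable def toricIdeal (k : Type*) [Field k] (A : Finset (Fin m → ℕ)) :
    Ideal (MvPolynomial A k) :=
  RingHom.ker (MvPolynomial.aeval (R := k)
    (fun a : A => ∏ j : Fin m, (MvPolynomial.X j : MvPolynomial (Fin m) k) ^ (a : Fin m → ℕ) j))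

/-- An ideal is a complete intersection if its minimal number of generators is its height. -/
def IsCompleteIntersection {R : Type*} [CommRing R] (I : Ideal R) : Prop :=
  I.FG ∧ (Submodule.spanFinrank I : ℕ∞) = I.height

/-- `A` is a set of more than `m` nonzero vectors of `ℕ^m` that contains `d_1 e_1, …, d_m e_m`. -/
structure IsSimplicial (A : Finset (Fin m → ℕ)) (d : Fin m → ℕ) : Prop where
  zero_notMem : (0 : Fin m → ℕ) ∉ A
  card_lt : m < A.card
  pos : ∀ j, 0 < d j
  single_mem : ∀ j, (Pi.single j (d j) : Fin m → ℕ) ∈ A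

/-- The toric ideal of `A` is a simplicial projective toric ideal: `A` is simplicial with all the
`d_j` equal to one number `d`, and every element of `A` has coordinate sum `d`. -/
def IsSimplicialProjective (A : Finset (Fin m → ℕ)) : Prop :=
  ∃ d : ℕ, IsSimplicial A (fun _ => d) ∧ ∀ a ∈ A, ∑ j, a j = d

/-- `ℕ S`, the set of sums of elements of `S`. -/
def natSpan (S : Finset (Fin m → ℕ)) : AddSubmonoid (Fin m → ℕ) :=
  AddSubmonoid.closure (S : Set (Fin m → ℕ))

/-- A vector of `ℕ^m` seen in `ℤ^m`. -/
def toInt (a : Fin m → ℕ) : Fin m → ℤ := fun j => (a j : ℤ)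

/-- A vector of `ℕ^m` seen in `ℚ^m`. -/
def toRat (a : Fin m → ℕ) : Fin m → ℚ := fun j => (a j : ℚ)

/-- `ℤ S`, the subgroup of `ℤ^m` generated by `S`. -/
def intSpan (S : Finset (Fin m → ℕ)) : AddSubgroup (Fin m → ℤ) :=
  AddSubgroup.closure (toInt '' (S : Set (Fin m → ℕ)))

/-- `ℚ S`, the subspace of `ℚ^m` generated by `S`. -/
def ratSpan (S : Finset (Fin m → ℕ)) : Submodule ℚ (Fin m → ℚ) :=
  Submodule.span ℚ (toRat '' (S : Set (Fin m → ℕ)))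

/-- `min {b ∈ ℤ⁺ | b a ∈ ℤ S}`; it is used only when `a ∈ ℚ S`, and then the set is nonempty. -/
noncomputable def minMultiple (S : Finset (Fin m → ℕ)) (a : Fin m → ℕ) : ℕ :=
  sInf {b : ℕ | 0 < b ∧ b • toInt a ∈ intSpan S}

open Classical in
/-- The body of the inner loop: remove `a` from `S`; if `a` is in the rational span of what is
left, put `B a` back unless it is in the semigroup generated by what is left. -/
noncomputable def reduceStep (S : Finset (Fin m → ℕ)) (a : Fin m → ℕ) : Finset (Fin m → ℕ) :=
  if toRat a ∈ ratSpan (S.erase a) then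
    if minMultiple (S.erase a) a • a ∈ natSpan (S.erase a) then S.erase a
    else insert (minMultiple (S.erase a) a • a) (S.erase a)
  else S.erase a

/-- One pass of the outer loop takes `G` to `S`: the elements of `G` are processed one after
another, each exactly once, in some order. -/
def IsPass (G S : Finset (Fin m → ℕ)) : Prop :=
  ∃ l : List (Fin m → ℕ), l.Nodup ∧ l.toFinset = G ∧ S = l.foldl reduceStep G

/-- `IsReduction G R`: for some choice of the orders, the Reduction Algorithm on input `G`
terminates and returns `R`. Passes are repeated until the set is empty or a pass has left it
unchanged. -/
inductive IsReduction : Finset (Fin m → ℕ) → Finset (Fin m → ℕ) → Prop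
  | finish {G S : Finset (Fin m → ℕ)} : IsPass G S → (S = ∅ ∨ S = G) → IsReduction G S
  | again {G S R : Finset (Fin m → ℕ)} : IsPass G S → ¬ (S = ∅ ∨ S = G) → IsReduction S R →
      IsReduction G R

/-- The Reduction Algorithm on input `G` terminates whatever the chosen orders are. -/
inductive ReductionHalts : Finset (Fin m → ℕ) → Prop
  | intro (G : Finset (Fin m → ℕ)) :
      (∀ S, IsPass G S → ¬ (S = ∅ ∨ S = G) → ReductionHalts S) → ReductionHalts G

end ToricReduction

/-!
The toric ideal of `A` is governed by the congruence `{(u, v) | ∑ u_a a = ∑ v_a a}` on the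
exponent vectors. If pairs generate the congruence, then their binomials generate the ideal
(`toricKer_eq_span`). Conversely, if the ideal has `h` generators, then at most `h` of the
binomials span `I / 𝔪 I`, so they generate `I` by a graded form of Nakayama's lemma, and the
corresponding pairs generate the congruence (`hasRelations_of_span`). The height of the ideal of a
simplicial projective `A` is the number of elements of `A` off the coordinate axes: explicit
chains of toric primes bound it from below (`card_le_height_toricKer`) and from above
(`height_toricKer_add_le`). So `I` is a complete intersection if and only if the congruence is
generated by as many pairs as there are elements off the axes.

Every step of the algorithm preserves this condition (`IsSimplicialRays.reduceStep_invariant`): a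
rationally independent element takes part in no relation; if only multiples of `B` occur as
differences of exponents of `a`, then `a` may be replaced by `B a`; and an element that lies in
the semigroup of the others costs exactly one relation. These three facts are about arbitrary
commutative monoids. Steps also preserve that the vectors lie on different rays, which holds for
`A` because all its elements have the same coordinate sum. As the condition is trivial for the
empty set, it remains to see that it fails for a nonempty output `R`.

Passes decrease, lexicographically, the number of elements and the number of elements that are not
integral combinations of the others (`reduceStep_eq_or_lt`). This gives termination, and it shows
that no single step changes a nonempty output `R`: each element of `R` is an integral, but not a
nonnegative integral, combination of the others. Suppose that the condition holds for `R`. Since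
the rays are different, each `b` off the axes has its own generating pair, one side of which is a
multiple of `b`, and there are no other pairs (`exists_pairs_indexed`). If every such `b` occurred
in the other side of some pair, then the toric ideal would be properly contained in an ideal
generated by at most as many elements, some of them variables, which contradicts Krull's height
theorem (`exists_forall_apply_eq_zero`). So some `b` occurs in one pair only, as `c b`. Then `c`
divides the exponents of `b` in all relations; it is `1` because `b` is integral over the others,
and so `b` lies in the semigroup of the others, a contradiction.
-/

namespace ToricReduction

/-! ### Presentations of commutative monoids by few relations -/

/-- The congruence `{(u, v) | Φ u = Φ v}` of an additive map `Φ` is generated by at most `h` pairs.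
Being generated is expressed by the universal property: every congruence that contains the pairs
contains all of `{(u, v) | Φ u = Φ v}`. -/
def HasRelations {X N : Type*} [AddCommMonoid X] [AddCommMonoid N] (Φ : X →+ N) (h : ℕ) : Prop :=
  ∃ P : Finset (X × X), P.card ≤ h ∧ (∀ p ∈ P, Φ p.1 = Φ p.2) ∧
    ∀ C : AddCon X, (∀ p ∈ P, C p.1 p.2) → ∀ u v, Φ u = Φ v → C u v

section Transfer

variable {X Y N N' : Type*} [AddCommMonoid X] [AddCommMonoid Y] [AddCommMonoid N]
  [AddCommMonoid N']

/-- A generating set of relations can be moved along a map `ψ` that need not be additive, as long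
as `ψ` sends every translate of a generating pair to a related pair. -/
theorem rel_of_map_rel {Φ : X →+ N} {P : Finset (X × X)}
    (hP : ∀ C : AddCon X, (∀ p ∈ P, C p.1 p.2) → ∀ u v, Φ u = Φ v → C u v)
    (Φ' : Y →+ N') (C : AddCon Y) (ψ : X → Y)
    (hψ : ∀ p ∈ P, ∀ z, C (ψ (p.1 + z)) (ψ (p.2 + z)))
    (hlift : ∀ y y', Φ' y = Φ' y' → ∃ x x', Φ x = Φ x' ∧ ψ x = y ∧ ψ x' = y')
    (y y' : Y) (hy : Φ' y = Φ' y') : C y y' := by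
  let D : AddCon X :=
    { r := fun x x' => ∀ z, C (ψ (x + z)) (ψ (x' + z))
      iseqv := ⟨fun x z => C.refl _, fun h z => C.symm (h z), fun h h' z => C.trans (h z) (h' z)⟩
      add' := by
        intro w x y z h h' t
        have h1 := h (y + t)
        have h2 := h' (x + t)
        simp only [← add_assoc] at h1
        rw [show y + (x + t) = x + y + t by abel, show z + (x + t) = x + z + t by abel] at h2
        exact C.trans h1 h2 }
  obtain ⟨x, x', hx, rfl, rfl⟩ := hlift y y' hy
  have := hP D hψ x x' hx 0
  simpa using this

/-- For a set `T` that contains the summands of its elements, the congruence in which the elements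
of `T` are related only to themselves. -/
def isolatingCon (T : Set X) (hT : ∀ u v, u + v ∈ T → u ∈ T ∧ v ∈ T) : AddCon X where
  r u v := u = v ∨ (u ∉ T ∧ v ∉ T)
  iseqv := by
    refine ⟨fun u => Or.inl rfl, ?_, ?_⟩
    · rintro u v (rfl | h)
      · exact Or.inl rfl
      · exact Or.inr h.symm
    · rintro u v t (rfl | h) (rfl | h')
      · exact Or.inl rfl
      · exact Or.inr h'
      · exact Or.inr h
      · exact Or.inr ⟨h.1, h'.2⟩
  add' := by
    rintro u v s t (rfl | h) (rfl | h')
    · exact Or.inl rfl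
    · exact Or.inr ⟨fun h => h'.1 (hT _ _ h).2, fun h => h'.2 (hT _ _ h).2⟩
    · exact Or.inr ⟨fun h' => h.1 (hT _ _ h').1, fun h' => h.2 (hT _ _ h').1⟩
    · exact Or.inr ⟨fun h' => h.1 (hT _ _ h').1, fun h' => h.2 (hT _ _ h').1⟩

/-- If `T` contains the summands of its elements and some element of `T` takes part in a nontrivial
relation, then some nontrivial generating relation has a side in `T`. -/
theorem exists_pair_meeting {Φ : X →+ N} {P : Finset (X × X)} {T : Set X}
    (hT : ∀ u v, u + v ∈ T → u ∈ T ∧ v ∈ T)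
    (hP : ∀ C : AddCon X, (∀ p ∈ P, C p.1 p.2) → ∀ u v, Φ u = Φ v → C u v)
    {u v : X} (huv : Φ u = Φ v) (hne : u ≠ v) (hu : u ∈ T) :
    ∃ p ∈ P, p.1 ≠ p.2 ∧ (p.1 ∈ T ∨ p.2 ∈ T) := by
  by_contra! hcon
  have hD : ∀ p ∈ P, isolatingCon T hT p.1 p.2 := by
    intro p hp
    by_cases h : p.1 = p.2
    · exact Or.inl h
    · exact Or.inr (hcon p hp h)
  rcases hP (isolatingCon T hT) hD u v huv with h | h
  · exact hne h
  · exact h.1 hu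

theorem HasRelations.of_equiv {Φ : X →+ N} {h : ℕ} (e : X ≃+ Y) {Φ' : Y →+ N}
    (he : ∀ x, Φ' (e x) = Φ x) (H : HasRelations Φ h) : HasRelations Φ' h := by
  classical
  obtain ⟨P, hc, hP, hgen⟩ := H
  refine ⟨P.image (Prod.map e e), Finset.card_image_le.trans hc, ?_, fun C hC => ?_⟩
  · simp only [Finset.forall_mem_image]
    intro p hp
    simpa [he] using hP p hp
  · simp only [Finset.forall_mem_image] at hC
    refine rel_of_map_rel hgen Φ' C e (fun p hp z => ?_) fun y y' hy => ?_
    · rw [map_add e, map_add e]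
      exact C.add (hC hp) (C.refl _)
    · refine ⟨e.symm y, e.symm y', ?_, by simp, by simp⟩
      rw [← he, ← he]
      simpa using hy

theorem hasRelations_equiv {Φ : X →+ N} {h : ℕ} (e : X ≃+ Y) {Φ' : Y →+ N}
    (he : ∀ x, Φ' (e x) = Φ x) : HasRelations Φ h ↔ HasRelations Φ' h :=
  ⟨fun H => H.of_equiv e he, fun H => H.of_equiv e.symm fun y => by rw [← he]; simp⟩

end Transfer

section AddGenerator

variable {Y N : Type*} [AddCommMonoid Y] [AddCommMonoid N]

/-- The map `(n, y) ↦ n a + Φ y`: one more generator, of value `a`. -/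
def addGen (Φ : Y →+ N) (a : N) : ℕ × Y →+ N :=
  AddMonoidHom.coprod (multiplesHom N a) Φ

@[simp]
theorem addGen_apply (Φ : Y →+ N) (a : N) (n : ℕ) (y : Y) : addGen Φ a (n, y) = n • a + Φ y := by
  simp [addGen]

theorem addGen_apply' (Φ : Y →+ N) (a : N) (u : ℕ × Y) : addGen Φ a u = u.1 • a + Φ u.2 := by
  simp [addGen]

end AddGenerator

section Steps

variable {Y N : Type*} [AddCommMonoid Y] [AddCancelCommMonoid N]

/-- A generator that is independent of the others takes part in no relation. -/
theorem hasRelations_addGen_of_free {Φ : Y →+ N} {a : N} {h : ℕ}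
    (hfree : ∀ (n n' : ℕ) (y y' : Y), n • a + Φ y = n' • a + Φ y' → n = n') :
    HasRelations (addGen Φ a) h ↔ HasRelations Φ h := by
  classical
  constructor
  · rintro ⟨P, hc, hP, hgen⟩
    refine ⟨P.image fun p => (p.1.2, p.2.2), Finset.card_image_le.trans hc, ?_, fun C hC => ?_⟩
    · simp only [Finset.forall_mem_image]
      intro p hp
      have h1 := hP p hp
      rw [addGen_apply', addGen_apply'] at h1
      rw [hfree _ _ _ _ h1] at h1
      exact add_left_cancel h1
    · simp only [Finset.forall_mem_image] at hC
      refine rel_of_map_rel hgen Φ C Prod.snd (fun p hp z => C.add (hC hp) (C.refl _)) ?_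
      exact fun y y' hy => ⟨(0, y), (0, y'), by simpa using hy, rfl, rfl⟩
  · rintro ⟨P, hc, hP, hgen⟩
    refine ⟨P.image fun p => ((0, p.1), (0, p.2)), Finset.card_image_le.trans hc, ?_,
      fun C hC => ?_⟩
    · simp only [Finset.forall_mem_image]
      intro p hp
      simpa using hP p hp
    · simp only [Finset.forall_mem_image] at hC
      rintro ⟨n, y⟩ ⟨n', y'⟩ huv
      rw [addGen_apply, addGen_apply] at huv
      obtain rfl := hfree _ _ _ _ huv
      have key := hgen (C.comap (fun y => ((0 : ℕ), y)) (by simp)) (fun p hp => hC hp) y y'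
        (add_left_cancel huv)
      have := C.add (C.refl (n, (0 : Y))) key
      simpa using this

/-- If `B` divides all differences of exponents of `a` in relations, then `a` may be replaced by
`B a`. -/
theorem hasRelations_addGen_nsmul {Φ : Y →+ N} {a : N} {h B : ℕ} (hB : 0 < B)
    (hmod : ∀ (n n' : ℕ) (y y' : Y), n • a + Φ y = n' • a + Φ y' → n % B = n' % B) :
    HasRelations (addGen Φ a) h ↔ HasRelations (addGen Φ (B • a)) h := by
  classical
  have hdiv : ∀ n : ℕ, n • a = (n % B) • a + (n / B) • B • a := by
    intro n
    rw [← mul_nsmul', ← add_nsmul]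
    congr 1
    rw [mul_comm]
    exact (Nat.mod_add_div n B).symm
  constructor
  · rintro ⟨P, hc, hP, hgen⟩
    refine ⟨P.image fun p => ((p.1.1 / B, p.1.2), (p.2.1 / B, p.2.2)),
      Finset.card_image_le.trans hc, ?_, fun C hC => ?_⟩
    · simp only [Finset.forall_mem_image]
      intro p hp
      have h1 := hP p hp
      rw [addGen_apply', addGen_apply'] at h1
      have h2 := hmod _ _ _ _ h1
      rw [hdiv p.1.1, hdiv p.2.1, h2, add_assoc, add_assoc] at h1
      simpa using add_left_cancel h1
    · simp only [Finset.forall_mem_image] at hC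
      refine rel_of_map_rel hgen (addGen Φ (B • a)) C (fun u => (u.1 / B, u.2))
        (fun p hp z => ?_) ?_
      · have h1 := hP p hp
        rw [addGen_apply', addGen_apply'] at h1
        have h2 := hmod _ _ _ _ h1
        -- Both exponents leave the same remainder, so adding `z.1` produces the same carry.
        have hcarry : ∀ s : ℕ, (s + z.1) / B = s / B + (s % B + z.1) / B := by
          intro s
          conv_lhs => rw [← Nat.div_add_mod s B, add_assoc, Nat.mul_add_div hB]
        have h3 := C.add (hC hp) (C.refl ((p.1.1 % B + z.1) / B, z.2))
        simp only [Prod.mk_add_mk, Prod.fst_add, Prod.snd_add] at h3 ⊢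
        rw [hcarry p.1.1, hcarry p.2.1, ← h2]
        exact h3
      · rintro ⟨n, y⟩ ⟨n', y'⟩ huv
        refine ⟨(B * n, y), (B * n', y'), ?_, ?_, ?_⟩
        · simpa [mul_comm B, mul_nsmul'] using huv
        · simp [hB.ne']
        · simp [hB.ne']
  · rintro ⟨P, hc, hP, hgen⟩
    refine ⟨P.image fun p => ((B * p.1.1, p.1.2), (B * p.2.1, p.2.2)),
      Finset.card_image_le.trans hc, ?_, fun C hC => ?_⟩
    · simp only [Finset.forall_mem_image]
      intro p hp
      have h1 := hP p hp
      rw [addGen_apply', addGen_apply'] at h1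
      simpa [mul_comm B, mul_nsmul'] using h1
    · simp only [Finset.forall_mem_image] at hC
      rintro ⟨n, y⟩ ⟨n', y'⟩ huv
      rw [addGen_apply, addGen_apply] at huv
      have h2 := hmod _ _ _ _ huv
      rw [hdiv n, hdiv n', h2, add_assoc, add_assoc] at huv
      have key := hgen (C.comap (fun u : ℕ × Y => (B * u.1, u.2)) (by simp [mul_add]))
        (fun p hp => hC hp) (n / B, y) (n' / B, y') (by simpa using add_left_cancel huv)
      have h3 := C.add (C.refl (n % B, (0 : Y))) key
      simp only [Prod.mk_add_mk, zero_add, Nat.mod_add_div] at h3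
      rwa [h2, Nat.mod_add_div] at h3

theorem HasRelations.addGen_of_mem {Φ : Y →+ N} {h : ℕ} (w : Y) (H : HasRelations Φ h) :
    HasRelations (addGen Φ (Φ w)) (h + 1) := by
  classical
  obtain ⟨P, hc, hP, hgen⟩ := H
  refine ⟨insert ((1, 0), (0, w)) (P.image fun p => ((0, p.1), (0, p.2))),
    (Finset.card_insert_le _ _).trans (Nat.succ_le_succ (Finset.card_image_le.trans hc)), ?_,
    fun C hC => ?_⟩
  · simp only [Finset.forall_mem_insert, Finset.forall_mem_image]
    refine ⟨by simp, ?_⟩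
    intro p hp
    simpa using hP p hp
  · simp only [Finset.forall_mem_insert, Finset.forall_mem_image] at hC
    have hred : ∀ (n : ℕ) (y : Y), C (n, y) (0, n • w + y) := by
      intro n y
      have := C.add (C.nsmul n hC.1) (C.refl ((0 : ℕ), y))
      simpa using this
    rintro ⟨n, y⟩ ⟨n', y'⟩ huv
    have key := hgen (C.comap (fun y => ((0 : ℕ), y)) (by simp)) (fun p hp => hC.2 hp)
      (n • w + y) (n' • w + y') (by simpa using huv)
    exact C.trans (hred n y) (C.trans key (C.symm (hred n' y')))

/-- In a pointed situation a redundant generator `a = Φ w` must be expressed by one of the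
generating relations, and that relation can be used up to eliminate `a`. -/
theorem HasRelations.of_addGen_of_mem [PartialOrder N] [CanonicallyOrderedAdd N]
    {Φ : Y →+ N} {h : ℕ} (hΦ : ∀ y, Φ y = 0 → y = 0) {w : Y} (hw : w ≠ 0)
    (H : HasRelations (addGen Φ (Φ w)) (h + 1)) : HasRelations Φ h := by
  classical
  obtain ⟨P, hc, hP, hgen⟩ := H
  have hw0 : Φ w ≠ 0 := fun h => hw (hΦ w h)
  have hpt : ∀ u, addGen Φ (Φ w) u = 0 → u = 0 := by
    rintro ⟨n, y⟩ hu
    rw [addGen_apply, add_eq_zero] at hu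
    have hn : n = 0 := by
      rcases n with _ | n
      · rfl
      · rw [succ_nsmul, add_eq_zero] at hu
        exact absurd hu.1.2 hw0
    rw [hn, hΦ y hu.2]
    rfl
  have hsum : ∀ u v : ℕ × Y, u + v = 0 → u = 0 ∧ v = 0 := by
    intro u v huv
    have : addGen Φ (Φ w) u + addGen Φ (Φ w) v = 0 := by rw [← map_add, huv, map_zero]
    rw [add_eq_zero] at this
    exact ⟨hpt _ this.1, hpt _ this.2⟩
  let T : Set (ℕ × Y) := {u | u = 0 ∨ u = (1, 0)}
  have hT : ∀ u v, u + v ∈ T → u ∈ T ∧ v ∈ T := by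
    rintro ⟨n, y⟩ ⟨n', y'⟩ (huv | huv)
    · obtain ⟨h1, h2⟩ := hsum _ _ huv
      exact ⟨Or.inl h1, Or.inl h2⟩
    · rw [Prod.mk_add_mk, Prod.mk.injEq] at huv
      have h1 := hsum (0, y) (0, y') (by simp [huv.2])
      simp only [Prod.mk_eq_zero, true_and] at h1
      obtain ⟨rfl, rfl⟩ := h1
      have : (n = 0 ∧ n' = 1) ∨ (n = 1 ∧ n' = 0) := by omega
      rcases this with ⟨rfl, rfl⟩ | ⟨rfl, rfl⟩
      · exact ⟨Or.inl rfl, Or.inr rfl⟩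
      · exact ⟨Or.inr rfl, Or.inl rfl⟩
  -- The relation between the new generator and `w` is not in the congruence that isolates `T`, so
  -- some generating pair is not in it either.
  obtain ⟨p, hp, hpD'⟩ := exists_pair_meeting hT hgen (u := (1, 0)) (v := (0, w)) (by simp)
    (by simp) (Or.inr rfl)
  -- The exceptional pair relates the new generator to an element `w'` not involving it.
  have hside : ∀ u v : ℕ × Y, addGen Φ (Φ w) u = addGen Φ (Φ w) v → u ≠ v → u ∈ T →
      u = (1, 0) ∧ v.1 = 0 := by
    rintro u ⟨n, y⟩ huv hne (rfl | rfl)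
    · exact absurd (hpt _ (by rw [← huv, map_zero])).symm hne
    · refine ⟨rfl, ?_⟩
      rcases n with _ | n
      · rfl
      · exfalso
        have h1 : addGen Φ (Φ w) (1, 0) = addGen Φ (Φ w) (1, 0) + addGen Φ (Φ w) (n, y) := by
          refine huv.trans ?_
          rw [← map_add, Prod.mk_add_mk, zero_add, add_comm 1 n]
        have h2 := hpt _ (left_eq_add.mp h1)
        rw [Prod.mk_eq_zero] at h2
        obtain ⟨rfl, rfl⟩ := h2
        exact hne rfl
  obtain ⟨w', hw', hpw⟩ : ∃ w' : Y, Φ w' = Φ w ∧ p.1.1 • w' + p.1.2 = p.2.1 • w' + p.2.2 := by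
    obtain ⟨hne, h1 | h1⟩ := hpD'
    · obtain ⟨h2, h3⟩ := hside _ _ (hP p hp) hne h1
      refine ⟨p.2.2, ?_, by simp [h2, h3]⟩
      have := hP p hp
      rw [addGen_apply', addGen_apply', h2, h3] at this
      simpa using this.symm
    · obtain ⟨h2, h3⟩ := hside _ _ (hP p hp).symm hne.symm h1
      refine ⟨p.1.2, ?_, by simp [h2, h3]⟩
      have := hP p hp
      rw [addGen_apply', addGen_apply', h2, h3] at this
      simpa using this
  let ψ : ℕ × Y → Y := fun u => u.1 • w' + u.2
  have hψadd : ∀ u v, ψ (u + v) = ψ u + ψ v := by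
    intro u v
    simp only [ψ, Prod.fst_add, Prod.snd_add, add_nsmul]
    abel
  have hψΦ : ∀ u, Φ (ψ u) = addGen Φ (Φ w) u := by
    intro u
    simp [ψ, addGen_apply', hw']
  refine ⟨(P.erase p).image fun q => (ψ q.1, ψ q.2), ?_, ?_, fun C hC => ?_⟩
  · refine Finset.card_image_le.trans ?_
    rw [Finset.card_erase_of_mem hp]
    omega
  · simp only [Finset.forall_mem_image]
    intro q hq
    rw [hψΦ, hψΦ]
    exact hP q (Finset.mem_of_mem_erase hq)
  · simp only [Finset.forall_mem_image] at hC
    refine rel_of_map_rel hgen Φ C ψ (fun q hq z => ?_) ?_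
    · rw [hψadd, hψadd]
      by_cases hqp : q = p
      · subst hqp
        rw [show ψ q.1 = ψ q.2 from hpw]
        exact C.refl _
      · exact C.add (hC (Finset.mem_erase.mpr ⟨hqp, hq⟩)) (C.refl _)
    · exact fun y y' hy => ⟨(0, y), (0, y'), by simpa using hy, by simp [ψ], by simp [ψ]⟩

theorem hasRelations_addGen_of_mem [PartialOrder N] [CanonicallyOrderedAdd N]
    {Φ : Y →+ N} {h : ℕ} (hΦ : ∀ y, Φ y = 0 → y = 0) {w : Y} (hw : w ≠ 0) :
    HasRelations (addGen Φ (Φ w)) (h + 1) ↔ HasRelations Φ h :=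
  ⟨fun H => H.of_addGen_of_mem hΦ hw, fun H => H.addGen_of_mem w⟩

end Steps

variable {m : ℕ}

/-! ### The semigroup of a finite set of vectors -/

/-- The map `ℕ^σ → ℕ^m`, `u ↦ ∑ i, u i • a i`, whose congruence is the one of the toric ideal of the
family `a`. -/
noncomputable def valueMap {σ : Type*} (a : σ → Fin m → ℕ) : (σ →₀ ℕ) →+ (Fin m → ℕ) :=
  (Finsupp.linearCombination ℕ a).toAddMonoidHom

@[simp]
theorem valueMap_single {σ : Type*} (a : σ → Fin m → ℕ) (i : σ) (n : ℕ) :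
    valueMap a (Finsupp.single i n) = n • a i := by
  simp [valueMap]

theorem eq_zero_of_valueMap_eq_zero {σ : Type*} {a : σ → Fin m → ℕ} (ha : ∀ i, a i ≠ 0)
    {u : σ →₀ ℕ} (hu : valueMap a u = 0) : u = 0 := by
  ext i
  by_contra hi
  have h1 : u = Finsupp.single i (u i) + u.erase i := (Finsupp.single_add_erase i u).symm
  rw [h1, map_add, add_eq_zero, valueMap_single, smul_eq_zero] at hu
  rcases hu.1 with h | h
  · exact hi h
  · exact ha i h

/-- The congruence of the finite set `S` is generated by at most `h` pairs. -/
def SetHasRelations (S : Finset (Fin m → ℕ)) (h : ℕ) : Prop :=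
  HasRelations (valueMap ((↑) : S → Fin m → ℕ)) h

/-- `ℕ^(τ ∪ {∗}) = ℕ × ℕ^τ`. -/
noncomputable def optionFinsuppEquiv (τ : Type*) : (Option τ →₀ ℕ) ≃+ ℕ × (τ →₀ ℕ) :=
  { Finsupp.optionEquiv with map_add' := fun f g => by simp [Finsupp.optionEquiv] }

theorem setHasRelations_insert {T : Finset (Fin m → ℕ)} {a : Fin m → ℕ} (ha : a ∉ T) (h : ℕ) :
    SetHasRelations (insert a T) h ↔
      HasRelations (addGen (valueMap ((↑) : T → Fin m → ℕ)) a) h := by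
  classical
  refine hasRelations_equiv
    ((Finsupp.domCongr (Finset.subtypeInsertEquivOption ha)).trans (optionFinsuppEquiv T)) ?_
  have key : (addGen (valueMap ((↑) : T → Fin m → ℕ)) a).comp
      ((Finsupp.domCongr (Finset.subtypeInsertEquivOption ha)).trans
        (optionFinsuppEquiv T)).toAddMonoidHom =
      valueMap (fun i : ↥(insert a T) => (i : Fin m → ℕ)) := by
    refine Finsupp.addHom_ext fun i n => ?_
    obtain ⟨x, hx⟩ := i
    by_cases hxa : x = a
    · subst hxa
      simp [optionFinsuppEquiv, Finsupp.optionEquiv, Finset.subtypeInsertEquivOption,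
        addGen_apply']
    · simp [optionFinsuppEquiv, Finsupp.optionEquiv, Finset.subtypeInsertEquivOption,
        addGen_apply', hxa]
  exact fun x => DFunLike.congr_fun key x

/-- The elements of `ℕ E` are the values of exponent vectors supported on `E`. -/
theorem exists_valueMap_eq_of_mem_natSpan {S E : Finset (Fin m → ℕ)} (hE : E ⊆ S)
    {x : Fin m → ℕ} (hx : x ∈ natSpan E) :
    ∃ e : S →₀ ℕ, valueMap ((↑) : S → Fin m → ℕ) e = x ∧ ∀ i, e i ≠ 0 → (i : Fin m → ℕ) ∈ E := by
  classical
  induction hx using AddSubmonoid.closure_induction with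
  | mem x hx =>
    refine ⟨Finsupp.single ⟨x, hE hx⟩ 1, by simp, fun i hi => ?_⟩
    have : i = ⟨x, hE hx⟩ := by
      by_contra hne
      exact hi (Finsupp.single_eq_of_ne hne)
    rw [this]
    exact hx
  | zero => exact ⟨0, by simp, by simp⟩
  | add x y _ _ hx hy =>
    obtain ⟨e, he, he'⟩ := hx
    obtain ⟨f, hf, hf'⟩ := hy
    refine ⟨e + f, by rw [map_add, he, hf], fun i hi => ?_⟩
    rw [Finsupp.add_apply] at hi
    by_cases h : e i = 0
    · exact hf' i (by omega)
    · exact he' i h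

theorem valueMap_mem_natSpan {S E : Finset (Fin m → ℕ)} {e : S →₀ ℕ}
    (he : ∀ i, e i ≠ 0 → (i : Fin m → ℕ) ∈ E) :
    valueMap ((↑) : S → Fin m → ℕ) e ∈ natSpan E := by
  have : valueMap ((↑) : S → Fin m → ℕ) e = e.sum fun i n => n • (i : Fin m → ℕ) := by
    simp [valueMap, Finsupp.linearCombination_apply]
  rw [this]
  exact sum_mem fun i hi =>
    nsmul_mem (AddSubmonoid.subset_closure (he i (Finsupp.mem_support_iff.mp hi))) _

theorem mem_natSpan_iff {T : Finset (Fin m → ℕ)} {x : Fin m → ℕ} :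
    x ∈ natSpan T ↔ ∃ w, valueMap ((↑) : T → Fin m → ℕ) w = x := by
  constructor
  · intro hx
    obtain ⟨e, he, -⟩ := exists_valueMap_eq_of_mem_natSpan (Finset.Subset.refl T) hx
    exact ⟨e, he⟩
  · rintro ⟨w, rfl⟩
    exact valueMap_mem_natSpan fun i _ => i.2

theorem toInt_add (a b : Fin m → ℕ) : toInt (a + b) = toInt a + toInt b := by
  ext j; simp [toInt]

theorem toInt_nsmul (n : ℕ) (a : Fin m → ℕ) : toInt (n • a) = n • toInt a := by
  ext j; simp [toInt]

theorem toRat_add (a b : Fin m → ℕ) : toRat (a + b) = toRat a + toRat b := by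
  ext j; simp [toRat]

theorem toRat_nsmul (n : ℕ) (a : Fin m → ℕ) : toRat (n • a) = n • toRat a := by
  ext j; simp [toRat]

theorem toInt_mem_intSpan_of_mem {T : Finset (Fin m → ℕ)} {x : Fin m → ℕ} (hx : x ∈ T) :
    toInt x ∈ intSpan T :=
  AddSubgroup.subset_closure ⟨x, hx, rfl⟩

theorem toRat_mem_ratSpan_of_mem {T : Finset (Fin m → ℕ)} {x : Fin m → ℕ} (hx : x ∈ T) :
    toRat x ∈ ratSpan T :=
  Submodule.subset_span ⟨x, hx, rfl⟩

theorem toInt_mem_intSpan {T : Finset (Fin m → ℕ)} {x : Fin m → ℕ} (hx : x ∈ natSpan T) :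
    toInt x ∈ intSpan T := by
  induction hx using AddSubmonoid.closure_induction with
  | mem x hx => exact toInt_mem_intSpan_of_mem hx
  | zero =>
    rw [show toInt (0 : Fin m → ℕ) = 0 by ext j; simp [toInt]]
    exact zero_mem _
  | add x y _ _ hx hy =>
    rw [toInt_add]
    exact add_mem hx hy

theorem toRat_mem_ratSpan {T : Finset (Fin m → ℕ)} {x : Fin m → ℕ} (hx : x ∈ natSpan T) :
    toRat x ∈ ratSpan T := by
  induction hx using AddSubmonoid.closure_induction with
  | mem x hx => exact toRat_mem_ratSpan_of_mem hx
  | zero =>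
    rw [show toRat (0 : Fin m → ℕ) = 0 by ext j; simp [toRat]]
    exact zero_mem _
  | add x y _ _ hx hy =>
    rw [toRat_add]
    exact add_mem hx hy

theorem intSpan_mono {S T : Finset (Fin m → ℕ)} (h : S ⊆ T) : intSpan S ≤ intSpan T :=
  AddSubgroup.closure_mono (Set.image_mono (Finset.coe_subset.mpr h))

/-- Every integral vector of the rational span has a positive multiple in the integral span. -/
theorem exists_nsmul_mem_intSpan {T : Finset (Fin m → ℕ)} {a : Fin m → ℕ}
    (ha : toRat a ∈ ratSpan T) : ∃ b : ℕ, 0 < b ∧ b • toInt a ∈ intSpan T := by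
  have key : ∀ v ∈ ratSpan T,
      ∃ b : ℕ, 0 < b ∧ ∃ x ∈ intSpan T, ∀ j, (b : ℚ) * v j = (x j : ℤ) := by
    intro v hv
    induction hv using Submodule.span_induction with
    | mem v hv =>
      obtain ⟨x, hx, rfl⟩ := hv
      exact ⟨1, one_pos, toInt x, toInt_mem_intSpan_of_mem hx, by simp [toRat, toInt]⟩
    | zero => exact ⟨1, one_pos, 0, zero_mem _, by simp⟩
    | add v w _ _ hv hw =>
      obtain ⟨b, hb, x, hx, h⟩ := hv
      obtain ⟨c, hc, y, hy, h'⟩ := hw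
      refine ⟨b * c, Nat.mul_pos hb hc, c • x + b • y,
        add_mem (nsmul_mem hx _) (nsmul_mem hy _), fun j => ?_⟩
      have h1 := h j
      have h2 := h' j
      simp only [Pi.add_apply, Pi.smul_apply]
      simp only [nsmul_eq_mul]
      push_cast
      rw [← h1, ← h2]
      ring
    | smul q v _ hv =>
      obtain ⟨b, hb, x, hx, h⟩ := hv
      refine ⟨b * q.den, Nat.mul_pos hb q.den_pos, q.num • x, zsmul_mem hx _, fun j => ?_⟩
      have h1 := h j
      have h2 : (q.den : ℚ) * q = q.num := Rat.den_mul_eq_num q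
      simp only [Pi.smul_apply, smul_eq_mul]
      push_cast
      rw [← h1, ← h2]
      ring
  obtain ⟨b, hb, x, hx, h⟩ := key _ ha
  refine ⟨b, hb, ?_⟩
  convert hx using 1
  ext j
  have := h j
  simp only [toRat] at this
  simp only [toInt, Pi.smul_apply, nsmul_eq_mul]
  exact_mod_cast this

theorem minMultiple_spec {T : Finset (Fin m → ℕ)} {a : Fin m → ℕ} (ha : toRat a ∈ ratSpan T) :
    0 < minMultiple T a ∧ minMultiple T a • toInt a ∈ intSpan T :=
  Nat.sInf_mem (s := {b : ℕ | 0 < b ∧ b • toInt a ∈ intSpan T}) (exists_nsmul_mem_intSpan ha)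

/-- The multiples of `a` in `ℤ T` are the multiples of `minMultiple T a`. -/
theorem minMultiple_dvd {T : Finset (Fin m → ℕ)} {a : Fin m → ℕ} (ha : toRat a ∈ ratSpan T)
    {z : ℤ} (hz : z • toInt a ∈ intSpan T) : (minMultiple T a : ℤ) ∣ z := by
  obtain ⟨hpos, hmem⟩ := minMultiple_spec ha
  set B := minMultiple T a with hB
  by_contra hdvd
  have hr0 : 0 ≤ z % B := Int.emod_nonneg _ (by omega)
  have hr1 : z % B < B := Int.emod_lt_of_pos _ (by omega)
  have hr2 : z % B ≠ 0 := fun h => hdvd (Int.dvd_of_emod_eq_zero h)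
  have hmem' : (z % B).toNat • toInt a ∈ intSpan T := by
    have h1 : (z % B).toNat • toInt a = z • toInt a - (z / B) • B • toInt a := by
      rw [← natCast_zsmul, ← natCast_zsmul, smul_smul, ← sub_smul, Int.toNat_of_nonneg hr0,
        Int.emod_def, mul_comm (B : ℤ)]
    rw [h1]
    exact sub_mem hz (zsmul_mem hmem _)
  have h2 : B ≤ (z % B).toNat :=
    Nat.sInf_le (s := {b : ℕ | 0 < b ∧ b • toInt a ∈ intSpan T}) ⟨by omega, hmem'⟩
  omega

theorem mod_minMultiple_eq {T : Finset (Fin m → ℕ)} {a : Fin m → ℕ} (ha : toRat a ∈ ratSpan T)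
    (n n' : ℕ) (y y' : T →₀ ℕ)
    (h : n • a + valueMap ((↑) : T → Fin m → ℕ) y = n' • a + valueMap ((↑) : T → Fin m → ℕ) y') :
    n % minMultiple T a = n' % minMultiple T a := by
  have h1 : ((n' : ℤ) - n) • toInt a ∈ intSpan T := by
    have h2 := congrArg toInt h
    simp only [toInt_add, toInt_nsmul] at h2
    have h3 : ((n' : ℤ) - n) • toInt a = toInt (valueMap ((↑) : T → Fin m → ℕ) y) -
        toInt (valueMap ((↑) : T → Fin m → ℕ) y') := by
      rw [sub_smul, natCast_zsmul, natCast_zsmul, sub_eq_sub_iff_add_eq_add, add_comm _ (n • _)]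
      exact h2.symm
    rw [h3]
    exact sub_mem (toInt_mem_intSpan (mem_natSpan_iff.mpr ⟨y, rfl⟩))
      (toInt_mem_intSpan (mem_natSpan_iff.mpr ⟨y', rfl⟩))
  exact Nat.modEq_iff_dvd.mpr (minMultiple_dvd ha h1)

theorem eq_of_notMem_ratSpan {T : Finset (Fin m → ℕ)} {a : Fin m → ℕ} (ha : toRat a ∉ ratSpan T)
    (n n' : ℕ) (y y' : T →₀ ℕ)
    (h : n • a + valueMap ((↑) : T → Fin m → ℕ) y = n' • a + valueMap ((↑) : T → Fin m → ℕ) y') :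
    n = n' := by
  by_contra hne
  apply ha
  have h2 := congrArg toRat h
  simp only [toRat_add, toRat_nsmul] at h2
  have h3 : ((n' : ℚ) - n) • toRat a = toRat (valueMap ((↑) : T → Fin m → ℕ) y) -
      toRat (valueMap ((↑) : T → Fin m → ℕ) y') := by
    rw [sub_smul, Nat.cast_smul_eq_nsmul, Nat.cast_smul_eq_nsmul, sub_eq_sub_iff_add_eq_add,
      add_comm _ (n • _)]
    exact h2.symm
  have h4 : ((n' : ℚ) - n) ≠ 0 := sub_ne_zero.mpr fun h => hne (by exact_mod_cast h.symm)
  rw [← Submodule.smul_mem_iff _ h4, h3]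
  exact sub_mem (toRat_mem_ratSpan (mem_natSpan_iff.mpr ⟨y, rfl⟩))
    (toRat_mem_ratSpan (mem_natSpan_iff.mpr ⟨y', rfl⟩))

/-! ### The reduction step on simplicial sets of vectors -/

/-- The property of sets of vectors that the Reduction Algorithm preserves: the vectors are nonzero,
lie on different rays, and every coordinate axis that is used by some vector carries a vector. -/
structure IsSimplicialRays (S : Finset (Fin m → ℕ)) : Prop where
  ne_zero : ∀ a ∈ S, a ≠ 0
  eq_of_nsmul_eq : ∀ a ∈ S, ∀ b ∈ S, ∀ p q : ℕ, 0 < p → p • a = q • b → a = b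
  single_mem : ∀ a ∈ S, ∀ j, a j ≠ 0 → ∃ p, 0 < p ∧ (Pi.single j p : Fin m → ℕ) ∈ S

open Classical in
/-- The elements of `S` that do not lie on a coordinate axis. -/
noncomputable def offAxes (S : Finset (Fin m → ℕ)) : Finset (Fin m → ℕ) :=
  S.filter fun a => ∀ (j : Fin m) (p : ℕ), a ≠ Pi.single j p

theorem mem_offAxes {S : Finset (Fin m → ℕ)} {a : Fin m → ℕ} :
    a ∈ offAxes S ↔ a ∈ S ∧ ∀ (j : Fin m) (p : ℕ), a ≠ Pi.single j p := by
  simp [offAxes]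

theorem eq_single_of_forall_ne {a : Fin m → ℕ} {j : Fin m} (h : ∀ i, i ≠ j → a i = 0) :
    a = Pi.single j (a j) := by
  ext i
  by_cases hi : i = j
  · subst hi; simp
  · rw [h i hi, Pi.single_eq_of_ne hi]

theorem nsmul_ne_single_iff {a : Fin m → ℕ} {B : ℕ} (hB : 0 < B) :
    (∀ (j : Fin m) (p : ℕ), B • a ≠ Pi.single j p) ↔ ∀ (j : Fin m) (p : ℕ), a ≠ Pi.single j p := by
  constructor
  · rintro h j p rfl
    exact h j (B * p) (by rw [← Pi.single_smul, smul_eq_mul])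
  · intro h j p hp
    refine h j (a j) (eq_single_of_forall_ne fun i hi => ?_)
    have := congrFun hp i
    rw [Pi.single_eq_of_ne hi, Pi.smul_apply, smul_eq_zero] at this
    omega

theorem ratSingle_mem {T : Finset (Fin m → ℕ)} {j : Fin m} {p : ℕ} (hp : 0 < p)
    (h : (Pi.single j p : Fin m → ℕ) ∈ T) (r : ℚ) : (Pi.single j r : Fin m → ℚ) ∈ ratSpan T := by
  have h1 : (Pi.single j r : Fin m → ℚ) = (r / p) • toRat (Pi.single j p) := by
    have hp' : (p : ℚ) ≠ 0 := by positivity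
    ext i
    by_cases hi : i = j
    · subst hi; simp [toRat, hp']
    · simp [toRat, Pi.single_eq_of_ne hi]
  rw [h1]
  exact Submodule.smul_mem _ _ (toRat_mem_ratSpan_of_mem h)

theorem toRat_eq_sum (a : Fin m → ℕ) :
    toRat a = ∑ j, (Pi.single j (a j : ℚ) : Fin m → ℚ) :=
  (Finset.univ_sum_single (toRat a)).symm

namespace IsSimplicialRays

variable {S : Finset (Fin m → ℕ)}

theorem valueMap_eq_zero (hS : IsSimplicialRays S) {T : Finset (Fin m → ℕ)} (hT : T ⊆ S)
    (u : T →₀ ℕ) (hu : valueMap ((↑) : T → Fin m → ℕ) u = 0) : u = 0 :=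
  eq_zero_of_valueMap_eq_zero (fun i => hS.ne_zero _ (hT i.2)) hu

theorem toRat_mem_ratSpan_of_offAxes (hS : IsSimplicialRays S) {a : Fin m → ℕ}
    (ha : a ∈ offAxes S) : toRat a ∈ ratSpan (S.erase a) := by
  rw [mem_offAxes] at ha
  rw [toRat_eq_sum]
  refine sum_mem fun j _ => ?_
  by_cases hj : a j = 0
  · simp [hj]
  · obtain ⟨p, hp, hmem⟩ := hS.single_mem a ha.1 j hj
    exact ratSingle_mem hp (Finset.mem_erase.mpr ⟨(ha.2 j p).symm, hmem⟩) _

/-- An element on a coordinate axis has no multiple in the semigroup of the others, since it spans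
an extremal ray. -/
theorem nsmul_single_notMem (hS : IsSimplicialRays S) {j : Fin m} {p B : ℕ} (hB : 0 < B)
    (hp : (Pi.single j p : Fin m → ℕ) ∈ S) :
    B • (Pi.single j p : Fin m → ℕ) ∉ natSpan (S.erase (Pi.single j p)) := by
  have hp0 : p ≠ 0 := by
    rintro rfl
    exact hS.ne_zero _ hp (by simp)
  let K : AddSubmonoid (Fin m → ℕ) :=
    { carrier := {v | v = 0 ∨ ∃ i, i ≠ j ∧ v i ≠ 0}
      zero_mem' := Or.inl rfl
      add_mem' := by
        rintro v w (rfl | ⟨i, hi, hv⟩) hw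
        · simpa using hw
        · exact Or.inr ⟨i, hi, by simp [hv]⟩ }
  have hK : natSpan (S.erase (Pi.single j p)) ≤ K := by
    refine AddSubmonoid.closure_le.mpr fun s hs => ?_
    rw [Finset.mem_coe, Finset.mem_erase] at hs
    by_contra hcon
    have h1 : ∀ i, i ≠ j → s i = 0 := by
      intro i hi
      by_contra h
      exact hcon (Or.inr ⟨i, hi, h⟩)
    have h2 : p • s = s j • (Pi.single j p : Fin m → ℕ) := by
      conv_lhs => rw [eq_single_of_forall_ne h1]
      rw [← Pi.single_smul, ← Pi.single_smul, smul_eq_mul, smul_eq_mul, mul_comm]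
    exact hs.1 (hS.eq_of_nsmul_eq _ hs.2 _ hp _ _ (Nat.pos_of_ne_zero hp0) h2)
  intro hmem
  rcases hK hmem with h | ⟨i, hi, h⟩
  · rw [smul_eq_zero] at h
    rcases h with h | h
    · omega
    · exact hS.ne_zero _ hp h
  · exact h (by simp [Pi.single_eq_of_ne hi])

theorem erase (hS : IsSimplicialRays S) {a : Fin m → ℕ}
    (ha : ∀ c ∈ S, c ≠ a → ∀ j p, c j ≠ 0 → a ≠ Pi.single j p) : IsSimplicialRays (S.erase a) where
  ne_zero c hc := hS.ne_zero c (Finset.mem_of_mem_erase hc)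
  eq_of_nsmul_eq c hc b hb :=
    hS.eq_of_nsmul_eq c (Finset.mem_of_mem_erase hc) b (Finset.mem_of_mem_erase hb)
  single_mem c hc j hj := by
    rw [Finset.mem_erase] at hc
    obtain ⟨p, hp, hmem⟩ := hS.single_mem c hc.2 j hj
    exact ⟨p, hp, Finset.mem_erase.mpr ⟨(ha c hc.2 hc.1 j p hj).symm, hmem⟩⟩

/-- If `a` is rationally independent of the other elements, then it lies on a coordinate axis that
no other element uses. -/
theorem ne_single_of_notMem_ratSpan (hS : IsSimplicialRays S) {a : Fin m → ℕ}
    (ha : toRat a ∉ ratSpan (S.erase a)) (c : Fin m → ℕ) (hc : c ∈ S) (hca : c ≠ a) (j : Fin m)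
    (p : ℕ) (hj : c j ≠ 0) : a ≠ Pi.single j p := by
  rintro rfl
  apply ha
  have h1 : toRat c ∈ ratSpan (S.erase (Pi.single j p)) :=
    toRat_mem_ratSpan_of_mem (Finset.mem_erase.mpr ⟨hca, hc⟩)
  rw [toRat_eq_sum, ← Finset.add_sum_erase _ _ (Finset.mem_univ j)] at h1
  have h2 : ∑ i ∈ Finset.univ.erase j, (Pi.single i (c i : ℚ) : Fin m → ℚ) ∈
      ratSpan (S.erase (Pi.single j p)) := by
    refine sum_mem fun i hi => ?_
    by_cases hci : c i = 0
    · simp [hci]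
    · obtain ⟨q, hq, hmem⟩ := hS.single_mem c hc i hci
      refine ratSingle_mem hq (Finset.mem_erase.mpr ⟨fun h => ?_, hmem⟩) _
      have := congrFun h i
      rw [Pi.single_eq_same, Pi.single_eq_of_ne (Finset.ne_of_mem_erase hi)] at this
      omega
  rw [add_mem_cancel_right h2] at h1
  have h3 : toRat (Pi.single j p : Fin m → ℕ) =
      ((p : ℚ) / c j) • (Pi.single j (c j : ℚ) : Fin m → ℚ) := by
    have : (c j : ℚ) ≠ 0 := by exact_mod_cast hj
    ext i
    by_cases hi : i = j
    · subst hi; simp [toRat, this]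
    · simp [toRat, Pi.single_eq_of_ne hi]
  rw [h3]
  exact Submodule.smul_mem _ _ h1

theorem insert_nsmul (hS : IsSimplicialRays S) {a : Fin m → ℕ} (ha : a ∈ S) {B : ℕ} (hB : 0 < B) :
    IsSimplicialRays (insert (B • a) (S.erase a)) where
  ne_zero c hc := by
    rw [Finset.mem_insert, Finset.mem_erase] at hc
    rcases hc with rfl | hc
    · rw [Ne, smul_eq_zero, not_or]
      exact ⟨hB.ne', hS.ne_zero a ha⟩
    · exact hS.ne_zero c hc.2
  eq_of_nsmul_eq c hc b hb p q hp h := by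
    rw [Finset.mem_insert, Finset.mem_erase] at hc hb
    rcases hc with rfl | hc <;> rcases hb with rfl | hb
    · rfl
    · rw [← mul_nsmul'] at h
      exact absurd (hS.eq_of_nsmul_eq a ha b hb.2 _ _ (Nat.mul_pos hp hB) h).symm hb.1
    · rw [← mul_nsmul' a] at h
      exact absurd (hS.eq_of_nsmul_eq c hc.2 a ha _ _ hp h) hc.1
    · exact hS.eq_of_nsmul_eq c hc.2 b hb.2 p q hp h
  single_mem c hc j hj := by
    have h1 : ∃ c' ∈ S, c' j ≠ 0 := by
      rw [Finset.mem_insert, Finset.mem_erase] at hc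
      rcases hc with rfl | hc
      · refine ⟨a, ha, fun h => hj ?_⟩
        simp [h]
      · exact ⟨c, hc.2, hj⟩
    obtain ⟨c', hc', hj'⟩ := h1
    obtain ⟨p, hp, hmem⟩ := hS.single_mem c' hc' j hj'
    by_cases hpa : (Pi.single j p : Fin m → ℕ) = a
    · refine ⟨B * p, Nat.mul_pos hB hp, Finset.mem_insert.mpr (Or.inl ?_)⟩
      rw [← hpa, ← Pi.single_smul, smul_eq_mul]
    · exact ⟨p, hp, Finset.mem_insert_of_mem (Finset.mem_erase.mpr ⟨hpa, hmem⟩)⟩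

theorem card_offAxes_insert {T : Finset (Fin m → ℕ)} {a b : Fin m → ℕ} (ha : a ∉ T) (hb : b ∉ T)
    (hab : (∀ (j : Fin m) (p : ℕ), b ≠ Pi.single j p) ↔ ∀ (j : Fin m) (p : ℕ), a ≠ Pi.single j p) :
    (offAxes (insert b T)).card = (offAxes (insert a T)).card := by
  classical
  unfold offAxes
  rw [Finset.filter_insert, Finset.filter_insert]
  by_cases h : ∀ (j : Fin m) (p : ℕ), a ≠ Pi.single j p
  · rw [if_pos h, if_pos (hab.mpr h), Finset.card_insert_of_notMem, Finset.card_insert_of_notMem]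
    · exact fun h' => ha (Finset.mem_of_mem_filter _ h')
    · exact fun h' => hb (Finset.mem_of_mem_filter _ h')
  · rw [if_neg h, if_neg (mt hab.mp h)]

/-- The reduction step preserves the property that the number of elements off the coordinate axes
suffices as the number of generating relations. -/
theorem reduceStep_invariant (hS : IsSimplicialRays S) {a : Fin m → ℕ} (ha : a ∈ S) :
    IsSimplicialRays (reduceStep S a) ∧ (SetHasRelations S (offAxes S).card ↔
      SetHasRelations (reduceStep S a)
        (offAxes (reduceStep S a)).card) := by
  classical
  have haT : a ∉ S.erase a := Finset.notMem_erase a S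
  have hins : insert a (S.erase a) = S := Finset.insert_erase ha
  have hSrel : ∀ h, SetHasRelations S h ↔
      HasRelations (addGen (valueMap ((↑) : (S.erase a) → Fin m → ℕ)) a) h := by
    intro h
    rw [← setHasRelations_insert haT, hins]
  have hz := hS.valueMap_eq_zero (Finset.erase_subset a S)
  have hoff : offAxes (S.erase a) = (offAxes S).erase a := by
    unfold offAxes
    rw [Finset.filter_erase]
  unfold reduceStep
  split_ifs with h1 h2
  · obtain ⟨hB, -⟩ := minMultiple_spec h1
    set B := minMultiple (S.erase a) a with hBdef
    have haoff : ∀ (j : Fin m) (p : ℕ), a ≠ Pi.single j p := by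
      rintro j p rfl
      exact hS.nsmul_single_notMem hB ha h2
    have hmem : a ∈ offAxes S := mem_offAxes.mpr ⟨ha, haoff⟩
    refine ⟨hS.erase fun c _ _ j p _ => haoff j p, ?_⟩
    obtain ⟨w, hw⟩ := mem_natSpan_iff.mp h2
    have hw0 : w ≠ 0 := by
      rintro rfl
      rw [map_zero, eq_comm, smul_eq_zero] at hw
      rcases hw with h | h
      · omega
      · exact hS.ne_zero a ha h
    rw [hSrel, hasRelations_addGen_nsmul hB (mod_minMultiple_eq h1), ← hw, hoff,
      ← Finset.card_erase_add_one hmem]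
    exact hasRelations_addGen_of_mem hz hw0
  · obtain ⟨hB, -⟩ := minMultiple_spec h1
    set B := minMultiple (S.erase a) a with hBdef
    have hBa : B • a ∉ S.erase a := fun h => h2 (AddSubmonoid.subset_closure h)
    refine ⟨hS.insert_nsmul ha hB, ?_⟩
    rw [setHasRelations_insert hBa, card_offAxes_insert haT hBa (nsmul_ne_single_iff hB), hins,
      hSrel]
    exact hasRelations_addGen_nsmul hB (mod_minMultiple_eq h1)
  · have haoff : a ∉ offAxes S := fun h => h1 (hS.toRat_mem_ratSpan_of_offAxes h)
    refine ⟨hS.erase (hS.ne_single_of_notMem_ratSpan h1), ?_⟩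
    rw [hSrel, hoff, Finset.erase_eq_of_notMem haoff]
    exact hasRelations_addGen_of_free (eq_of_notMem_ratSpan h1)

end IsSimplicialRays

/-! ### Termination and the outcome of the algorithm -/

theorem mem_reduceStep {S : Finset (Fin m → ℕ)} {a c : Fin m → ℕ} (hc : c ∈ S) (hca : c ≠ a) :
    c ∈ reduceStep S a := by
  have h : c ∈ S.erase a := Finset.mem_erase.mpr ⟨hca, hc⟩
  unfold reduceStep
  split_ifs
  · exact h
  · exact Finset.mem_insert_of_mem h
  · exact h

open Classical in
/-- The elements of `S` that are not integral combinations of the others. -/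
noncomputable def nonIntegral (S : Finset (Fin m → ℕ)) : Finset (Fin m → ℕ) :=
  S.filter fun c => toInt c ∉ intSpan (S.erase c)

theorem mem_nonIntegral {S : Finset (Fin m → ℕ)} {c : Fin m → ℕ} :
    c ∈ nonIntegral S ↔ c ∈ S ∧ toInt c ∉ intSpan (S.erase c) := by
  simp [nonIntegral]

/-- Replacing `a` by `B a` makes this element integral over the others and keeps the other elements
integral over the rest. -/
theorem nonIntegral_insert_subset {S : Finset (Fin m → ℕ)} {a : Fin m → ℕ} (ha : a ∈ S)
    (h1 : toRat a ∈ ratSpan (S.erase a))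
    (h2 : minMultiple (S.erase a) a • a ∉ natSpan (S.erase a)) :
    nonIntegral (insert (minMultiple (S.erase a) a • a) (S.erase a)) ⊆ (nonIntegral S).erase a := by
  classical
  obtain ⟨hB, hBmem⟩ := minMultiple_spec h1
  set B := minMultiple (S.erase a) a with hBdef
  have hBa : B • a ∉ S.erase a := fun h => h2 (AddSubmonoid.subset_closure h)
  intro c hc
  rw [mem_nonIntegral] at hc
  obtain ⟨hc, hcint⟩ := hc
  have hcB : c ≠ B • a := by
    rintro rfl
    rw [Finset.erase_insert hBa, toInt_nsmul] at hcint
    exact hcint hBmem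
  have hcS := Finset.mem_of_mem_insert_of_ne hc hcB
  rw [Finset.mem_erase, mem_nonIntegral]
  refine ⟨Finset.ne_of_mem_erase hcS, Finset.mem_of_mem_erase hcS, fun hcon => hcint ?_⟩
  have hca := Finset.ne_of_mem_erase hcS
  -- In `c = x + n a` the multiple `n a` is integral over the others, so `B` divides `n`.
  have hsplit : intSpan (S.erase c) ≤
      intSpan ((S.erase a).erase c) ⊔ AddSubgroup.zmultiples (toInt a) := by
    refine (AddSubgroup.closure_le _).mpr ?_
    rintro _ ⟨s, hs, rfl⟩
    rw [Finset.mem_coe, Finset.mem_erase] at hs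
    by_cases hsa : s = a
    · subst hsa
      exact AddSubgroup.mem_sup_right (AddSubgroup.mem_zmultiples _)
    · refine AddSubgroup.mem_sup_left (toInt_mem_intSpan_of_mem ?_)
      simp [hs.1, hs.2, hsa]
  obtain ⟨x, hx, y, hy, hxy⟩ := AddSubgroup.mem_sup.mp (hsplit hcon)
  obtain ⟨n, rfl⟩ := AddSubgroup.mem_zmultiples_iff.mp hy
  have hn : n • toInt a ∈ intSpan (S.erase a) := by
    have : n • toInt a = toInt c - x := by rw [← hxy]; abel
    rw [this]
    exact sub_mem (toInt_mem_intSpan_of_mem hcS) (intSpan_mono (Finset.erase_subset _ _) hx)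
  obtain ⟨t, rfl⟩ := minMultiple_dvd h1 hn
  rw [← hxy]
  refine add_mem (intSpan_mono ?_ hx) ?_
  · exact Finset.erase_subset_erase _ (Finset.subset_insert _ _)
  · rw [mul_comm, mul_smul, ← hBdef, natCast_zsmul, ← toInt_nsmul]
    exact zsmul_mem (toInt_mem_intSpan_of_mem
      (Finset.mem_erase.mpr ⟨hcB.symm, Finset.mem_insert_self _ _⟩)) _

/-- The quantity that decreases along the algorithm, in lexicographic order: the number of elements
and the number of nonintegral elements. -/
noncomputable def reductionMeasure (S : Finset (Fin m → ℕ)) : ℕ ×ₗ ℕ :=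
  toLex (S.card, (nonIntegral S).card)

theorem reduceStep_eq_or_lt {S : Finset (Fin m → ℕ)} {a : Fin m → ℕ} (ha : a ∈ S) :
    reduceStep S a = S ∨ reductionMeasure (reduceStep S a) < reductionMeasure S := by
  classical
  have herase : reductionMeasure (S.erase a) < reductionMeasure S :=
    Prod.Lex.toLex_lt_toLex.mpr (Or.inl (Finset.card_erase_lt_of_mem ha))
  unfold reduceStep
  split_ifs with h1 h2
  · exact Or.inr herase
  · obtain ⟨hB, hBmem⟩ := minMultiple_spec h1
    by_cases hB1 : minMultiple (S.erase a) a = 1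
    · left
      rw [hB1, one_smul, Finset.insert_erase ha]
    · right
      have hBa : minMultiple (S.erase a) a • a ∉ S.erase a :=
        fun h => h2 (AddSubmonoid.subset_closure h)
      have haN : a ∈ nonIntegral S := by
        refine mem_nonIntegral.mpr ⟨ha, fun h => hB1 ?_⟩
        have := minMultiple_dvd h1 (z := 1) (by rwa [one_smul])
        have := Int.le_of_dvd one_pos this
        omega
      refine Prod.Lex.toLex_lt_toLex.mpr (Or.inr ⟨?_, ?_⟩)
      · rw [Finset.card_insert_of_notMem hBa, Finset.card_erase_add_one ha]
      · exact (Finset.card_le_card (nonIntegral_insert_subset ha h1 h2)).trans_lt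
          (Finset.card_erase_lt_of_mem haN)
  · exact Or.inr herase

theorem foldl_reduceStep_eq_or_lt (l : List (Fin m → ℕ)) (hl : l.Nodup) :
    ∀ S : Finset (Fin m → ℕ), (∀ a ∈ l, a ∈ S) →
      (l.foldl reduceStep S = S ∧ ∀ a ∈ l, reduceStep S a = S) ∨
        reductionMeasure (l.foldl reduceStep S) < reductionMeasure S := by
  induction l with
  | nil => exact fun S _ => Or.inl ⟨rfl, by simp⟩
  | cons a l ih =>
    intro S hS
    rw [List.nodup_cons] at hl
    have hstep := reduceStep_eq_or_lt (hS a (by simp))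
    have hS' : ∀ c ∈ l, c ∈ reduceStep S a := fun c hc =>
      mem_reduceStep (hS c (by simp [hc])) fun h => hl.1 (h ▸ hc)
    rw [List.foldl_cons]
    rcases ih hl.2 _ hS' with ⟨h1, h2⟩ | h1 <;> rcases hstep with h3 | h3
    · rw [h3] at h1 h2
      left
      rw [h3]
      refine ⟨h1, ?_⟩
      simpa [h3] using h2
    · rw [h1]
      exact Or.inr h3
    · rw [h3] at h1
      rw [h3]
      exact Or.inr h1
    · exact Or.inr (h1.trans h3)

theorem IsPass.eq_or_lt {G S : Finset (Fin m → ℕ)} (h : IsPass G S) :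
    (S = G ∧ ∀ a ∈ G, reduceStep G a = G) ∨ reductionMeasure S < reductionMeasure G := by
  obtain ⟨l, hl, rfl, rfl⟩ := h
  rcases foldl_reduceStep_eq_or_lt l hl l.toFinset (by simp) with h | h
  · exact Or.inl ⟨h.1, fun a ha => h.2 a (List.mem_toFinset.mp ha)⟩
  · exact Or.inr h

theorem IsPass.lt_of_not {G S : Finset (Fin m → ℕ)} (h : IsPass G S) (hne : ¬ (S = ∅ ∨ S = G)) :
    reductionMeasure S < reductionMeasure G :=
  h.eq_or_lt.resolve_left fun h' => hne (Or.inr h'.1)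

theorem reductionHalts (G : Finset (Fin m → ℕ)) : ReductionHalts G := by
  induction hμ : reductionMeasure G using WellFoundedLT.induction generalizing G with
  | ind μ ih =>
    subst hμ
    exact ReductionHalts.intro G fun S hS hne => ih _ (hS.lt_of_not hne) S rfl

theorem exists_isReduction (G : Finset (Fin m → ℕ)) : ∃ R, IsReduction G R := by
  induction hμ : reductionMeasure G using WellFoundedLT.induction generalizing G with
  | ind μ ih =>
    subst hμ
    have hpass : IsPass G (G.toList.foldl reduceStep G) :=
      ⟨G.toList, G.nodup_toList, Finset.toList_toFinset G, rfl⟩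
    by_cases hne : G.toList.foldl reduceStep G = ∅ ∨ G.toList.foldl reduceStep G = G
    · exact ⟨_, .finish hpass hne⟩
    · obtain ⟨R, hR⟩ := ih _ (hpass.lt_of_not hne) _ rfl
      exact ⟨R, .again hpass hne hR⟩

/-- A nonempty output of the algorithm is fixed by all reduction steps. -/
theorem IsReduction.eq_empty_or_forall {G R : Finset (Fin m → ℕ)} (h : IsReduction G R) :
    R = ∅ ∨ ∀ a ∈ R, reduceStep R a = R := by
  induction h with
  | finish hpass hS =>
    rcases hS with h | h
    · exact Or.inl h
    · subst h
      rcases hpass.eq_or_lt with h | h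
      · exact Or.inr h.2
      · exact absurd h (lt_irrefl _)
  | again _ _ _ ih => exact ih

theorem mem_of_reduceStep_eq {R : Finset (Fin m → ℕ)} {a : Fin m → ℕ} (ha : a ∈ R)
    (h : reduceStep R a = R) :
    toRat a ∈ ratSpan (R.erase a) ∧ toInt a ∈ intSpan (R.erase a) ∧ a ∉ natSpan (R.erase a) := by
  have hne : R.erase a ≠ R := fun h' =>
    Finset.notMem_erase a R (by rw [h']; exact ha)
  unfold reduceStep at h
  split_ifs at h with h1 h2
  · exact absurd h hne
  · have h3 : a ∈ insert (minMultiple (R.erase a) a • a) (R.erase a) := by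
      rw [h]; exact ha
    rw [Finset.mem_insert, or_iff_left (Finset.notMem_erase a R)] at h3
    obtain ⟨-, hmem⟩ := minMultiple_spec h1
    rw [← h3] at h2
    rw [← toInt_nsmul, ← h3] at hmem
    exact ⟨h1, hmem, h2⟩
  · exact absurd h hne

theorem foldl_reduceStep_invariant (l : List (Fin m → ℕ)) (hl : l.Nodup) :
    ∀ S : Finset (Fin m → ℕ), (∀ a ∈ l, a ∈ S) → IsSimplicialRays S →
      IsSimplicialRays (l.foldl reduceStep S) ∧ (SetHasRelations S (offAxes S).card ↔
        SetHasRelations (l.foldl reduceStep S) (offAxes (l.foldl reduceStep S)).card) := by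
  induction l with
  | nil => exact fun S _ hS => ⟨hS, Iff.rfl⟩
  | cons a l ih =>
    intro S hmem hS
    rw [List.nodup_cons] at hl
    have hmem' : ∀ c ∈ l, c ∈ reduceStep S a := fun c hc =>
      mem_reduceStep (hmem c (by simp [hc])) fun h => hl.1 (h ▸ hc)
    obtain ⟨h1, h2⟩ := hS.reduceStep_invariant (hmem a (by simp))
    obtain ⟨h3, h4⟩ := ih hl.2 _ hmem' h1
    exact ⟨h3, h2.trans h4⟩

theorem IsPass.invariant {G S : Finset (Fin m → ℕ)} (h : IsPass G S) (hG : IsSimplicialRays G) :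
    IsSimplicialRays S ∧ (SetHasRelations G (offAxes G).card ↔
      SetHasRelations S (offAxes S).card) := by
  obtain ⟨l, hl, rfl, rfl⟩ := h
  exact foldl_reduceStep_invariant l hl _ (by simp) hG

theorem IsReduction.invariant {G R : Finset (Fin m → ℕ)} (h : IsReduction G R)
    (hG : IsSimplicialRays G) :
    IsSimplicialRays R ∧ (SetHasRelations G (offAxes G).card ↔
      SetHasRelations R (offAxes R).card) := by
  induction h with
  | finish hpass _ => exact hpass.invariant hG
  | again hpass _ _ ih =>
    obtain ⟨h1, h2⟩ := hpass.invariant hG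
    obtain ⟨h3, h4⟩ := ih h1
    exact ⟨h3, h2.trans h4⟩

open MvPolynomial

/-! ### Generators of toric ideals and generators of congruences -/

section Ideals

variable (k : Type*) [Field k] {σ : Type*} (a : σ → Fin m → ℕ)

/-- The homomorphism `x_i ↦ t^(a i)`. -/
noncomputable def toricHom : MvPolynomial σ k →ₐ[k] MvPolynomial (Fin m) k :=
  aeval fun i => ∏ j : Fin m, (X j : MvPolynomial (Fin m) k) ^ a i j

/-- The toric ideal of a family of vectors. -/
noncomputable def toricKer : Ideal (MvPolynomial σ k) := RingHom.ker (toricHom k a)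

theorem toricIdeal_eq_toricKer (A : Finset (Fin m → ℕ)) :
    toricIdeal k A = toricKer k ((↑) : A → Fin m → ℕ) := rfl

/-- The binomial `x^u - x^v` of a pair of exponent vectors. -/
noncomputable def binomial (p : (σ →₀ ℕ) × (σ →₀ ℕ)) : MvPolynomial σ k :=
  monomial p.1 1 - monomial p.2 1

variable {k a}

instance toricKer_isPrime : (toricKer k a).IsPrime := RingHom.ker_isPrime _

theorem prod_X_pow_eq_monomial (x : Fin m → ℕ) :
    ∏ j : Fin m, (X j : MvPolynomial (Fin m) k) ^ x j =
      monomial (Finsupp.equivFunOnFinite.symm x) 1 := by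
  rw [monomial_eq, C_1, one_mul, Finsupp.prod_fintype _ _ (by simp)]
  rfl

theorem toricHom_monomial (u : σ →₀ ℕ) (c : k) :
    toricHom k a (monomial u c) = monomial (Finsupp.equivFunOnFinite.symm (valueMap a u)) c := by
  have key : ∀ u : σ →₀ ℕ, toricHom k a (monomial u 1) =
      monomial (Finsupp.equivFunOnFinite.symm (valueMap a u)) 1 := by
    intro u
    induction u using Finsupp.induction_linear with
    | zero =>
      rw [map_zero, show (Finsupp.equivFunOnFinite.symm (0 : Fin m → ℕ)) = 0 by ext; rfl]
      simp
    | add u v hu hv =>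
      rw [map_add, show (Finsupp.equivFunOnFinite.symm (valueMap a u + valueMap a v)) =
        Finsupp.equivFunOnFinite.symm (valueMap a u) +
          Finsupp.equivFunOnFinite.symm (valueMap a v) by ext; rfl]
      rw [← one_mul (1 : k), ← monomial_mul, ← monomial_mul, map_mul, hu, hv]
    | single i n =>
      rw [valueMap_single, toricHom, ← X_pow_eq_monomial, map_pow, aeval_X,
        prod_X_pow_eq_monomial, monomial_pow, one_pow]
      exact congrArg (monomial · 1) (by ext; rfl)
  rw [← mul_one c, ← smul_eq_mul, ← smul_monomial, ← smul_monomial, map_smul, key]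

theorem binomial_mem_toricKer {p : (σ →₀ ℕ) × (σ →₀ ℕ)}
    (hp : valueMap a p.1 = valueMap a p.2) : binomial k p ∈ toricKer k a := by
  rw [toricKer, RingHom.mem_ker, binomial, map_sub, toricHom_monomial, toricHom_monomial, hp,
    sub_self]

theorem X_notMem_toricKer (i : σ) : (X i : MvPolynomial σ k) ∉ toricKer k a := by
  rw [toricKer, RingHom.mem_ker, X, toricHom_monomial, monomial_eq_zero]
  exact one_ne_zero

/-- A toric ideal is spanned by its binomials. -/
theorem toricKer_le {J : Ideal (MvPolynomial σ k)}
    (hJ : ∀ u v, valueMap a u = valueMap a v → binomial k (u, v) ∈ J) : toricKer k a ≤ J := by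
  classical
  -- A linear map from `k[t]` that sends `t^(valueMap a u)` to the class of `x^u` modulo `J`.
  let s : MvPolynomial (Fin m) k →ₗ[k] MvPolynomial σ k ⧸ J :=
    (basisMonomials (Fin m) k).constr k fun x =>
      if h : ∃ u, valueMap a u = x then Ideal.Quotient.mk J (monomial h.choose 1) else 0
  have hs : s ∘ₗ (toricHom k a).toLinearMap = (Ideal.Quotient.mkₐ k J).toLinearMap := by
    refine (basisMonomials σ k).ext fun u => ?_
    have hex : ∃ u', valueMap a u' = ⇑(Finsupp.equivFunOnFinite.symm (valueMap a u)) := ⟨u, rfl⟩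
    have h1 : s (monomial (Finsupp.equivFunOnFinite.symm (valueMap a u)) 1) =
        Ideal.Quotient.mk J (monomial hex.choose 1) := by
      have h2 := (basisMonomials (Fin m) k).constr_basis k
        (fun x => if h : ∃ u, valueMap a u = x then
          Ideal.Quotient.mk J (monomial h.choose 1) else 0)
        (Finsupp.equivFunOnFinite.symm (valueMap a u))
      rw [coe_basisMonomials] at h2
      rw [dif_pos hex] at h2
      exact h2
    rw [coe_basisMonomials]
    simp only [LinearMap.comp_apply, AlgHom.toLinearMap_apply, toricHom_monomial, h1]
    exact Ideal.Quotient.eq.mpr (hJ _ _ hex.choose_spec)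
  intro f hf
  rw [toricKer, RingHom.mem_ker] at hf
  have h3 := LinearMap.congr_fun hs f
  simp only [LinearMap.comp_apply, AlgHom.toLinearMap_apply] at h3
  rw [hf, map_zero] at h3
  exact Ideal.Quotient.eq_zero_iff_mem.mp h3.symm

/-- Pairs that generate the congruence give binomials that generate the toric ideal. -/
theorem toricKer_eq_span {P : Finset ((σ →₀ ℕ) × (σ →₀ ℕ))}
    (hP : ∀ p ∈ P, valueMap a p.1 = valueMap a p.2)
    (hgen : ∀ C : AddCon (σ →₀ ℕ), (∀ p ∈ P, C p.1 p.2) →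
      ∀ u v, valueMap a u = valueMap a v → C u v) :
    toricKer k a = Ideal.span (binomial k '' (P : Set ((σ →₀ ℕ) × (σ →₀ ℕ)))) := by
  refine le_antisymm (toricKer_le fun u v huv => ?_) ?_
  · set J := Ideal.span (binomial k '' (P : Set ((σ →₀ ℕ) × (σ →₀ ℕ)))) with hJ
    let C : AddCon (σ →₀ ℕ) :=
      { r := fun u v => binomial k (u, v) ∈ J
        iseqv := by
          refine ⟨fun u => by simp [binomial], fun {u v} h => ?_, fun {u v w} h h' => ?_⟩
          · have := neg_mem h
            simpa [binomial] using this
          · have := add_mem h h'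
            simpa [binomial] using this
        add' := by
          intro u v w z h h'
          have h1 := J.mul_mem_left (monomial w 1) h
          have h2 := J.mul_mem_left (monomial v 1) h'
          have h3 := add_mem h1 h2
          simp only [binomial, mul_sub, monomial_mul, mul_one] at h3 ⊢
          rw [add_comm w u, add_comm w v] at h3
          simpa using h3 }
    exact hgen C (fun p hp => Ideal.subset_span ⟨p, hp, rfl⟩) u v huv
  · rw [Ideal.span_le]
    rintro _ ⟨p, hp, rfl⟩
    exact binomial_mem_toricKer (hP p hp)

theorem exists_finset_span_of_hasRelations {h : ℕ} (H : HasRelations (valueMap a) h) :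
    ∃ s : Finset (MvPolynomial σ k), s.card ≤ h ∧ toricKer k a = Ideal.span s := by
  classical
  obtain ⟨P, hc, hP, hgen⟩ := H
  refine ⟨P.image (binomial k), Finset.card_image_le.trans hc, ?_⟩
  rw [toricKer_eq_span hP hgen, Finset.coe_image]

/-- Pairs whose binomials generate the toric ideal generate the congruence. -/
theorem rel_of_toricKer_le_span {P : Finset ((σ →₀ ℕ) × (σ →₀ ℕ))}
    (hspan : toricKer k a ≤ Ideal.span (binomial k '' (P : Set ((σ →₀ ℕ) × (σ →₀ ℕ)))))
    (C : AddCon (σ →₀ ℕ)) (hC : ∀ p ∈ P, C p.1 p.2) (u v : σ →₀ ℕ)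
    (huv : valueMap a u = valueMap a v) : C u v := by
  let q : MvPolynomial σ k →+* AddMonoidAlgebra k C.Quotient :=
    AddMonoidAlgebra.mapDomainRingHom k C.mk'
  have hq : ∀ u : σ →₀ ℕ, q (monomial u 1) = AddMonoidAlgebra.single (C.mk' u) 1 := fun u =>
    AddMonoidAlgebra.mapDomain_single
  have hle : Ideal.span (binomial k '' (P : Set ((σ →₀ ℕ) × (σ →₀ ℕ)))) ≤ RingHom.ker q := by
    rw [Ideal.span_le]
    rintro _ ⟨p, hp, rfl⟩
    rw [SetLike.mem_coe, RingHom.mem_ker, binomial, map_sub, hq, hq,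
      show C.mk' p.1 = C.mk' p.2 from C.eq.mpr (hC p hp), sub_self]
  have h1 := hle (hspan (binomial_mem_toricKer (p := (u, v)) huv))
  rw [RingHom.mem_ker, binomial, map_sub, hq, hq, sub_eq_zero] at h1
  exact C.eq.mp ((AddMonoidAlgebra.single_left_inj one_ne_zero).mp h1)

/-! ### Graded Nakayama for toric ideals -/

/-- Modulo `𝔪 I` an ideal is spanned over `k` by any set of generators. -/
theorem mkQ_mem_span {I : Ideal (MvPolynomial σ k)} {T : Set (MvPolynomial σ k)} (hT : T ⊆ I)
    {f : MvPolynomial σ k} (hf : f ∈ Ideal.span T) :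
    Ideal.Quotient.mkₐ k (RingHom.ker (constantCoeff (R := k) (σ := σ)) * I) f ∈
      Submodule.span k
        (Ideal.Quotient.mkₐ k (RingHom.ker (constantCoeff (R := k) (σ := σ)) * I) '' T) := by
  induction hf using Submodule.span_induction with
  | mem x hx => exact Submodule.subset_span ⟨x, hx, rfl⟩
  | zero => rw [map_zero]; exact zero_mem _
  | add x y _ _ hx hy => rw [map_add]; exact add_mem hx hy
  | smul r x hxT hx =>
    have hxI : x ∈ I := Ideal.span_le.mpr hT hxT
    have h1 : Ideal.Quotient.mkₐ k (RingHom.ker (constantCoeff (R := k) (σ := σ)) * I) (r • x) =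
        constantCoeff r • Ideal.Quotient.mkₐ k
          (RingHom.ker (constantCoeff (R := k) (σ := σ)) * I) x := by
      rw [← map_smul]
      refine Ideal.Quotient.eq.mpr ?_
      rw [smul_eq_mul, smul_eq_C_mul, ← sub_mul]
      exact Ideal.mul_mem_mul (by simp [RingHom.mem_ker]) hxI
    rw [h1]
    exact Submodule.smul_mem _ _ hx

/-- The weights `∑ j, a i j`, for which the toric ideal is homogeneous. -/
def totalWeight (a : σ → Fin m → ℕ) (i : σ) : ℕ := ∑ j, a i j

theorem weight_totalWeight (u : σ →₀ ℕ) :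
    Finsupp.weight (totalWeight a) u = ∑ j, valueMap a u j := by
  induction u using Finsupp.induction_linear with
  | zero => simp
  | add u v hu hv => simp [hu, hv, Finset.sum_add_distrib]
  | single i n => simp [Finsupp.weight_single, totalWeight, Finset.mul_sum]

theorem weight_totalWeight_eq_zero (ha : ∀ i, a i ≠ 0) {u : σ →₀ ℕ}
    (hu : Finsupp.weight (totalWeight a) u = 0) : u = 0 := by
  rw [weight_totalWeight, Finset.sum_eq_zero_iff] at hu
  refine eq_zero_of_valueMap_eq_zero ha ?_
  ext j
  exact hu j (Finset.mem_univ j)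

theorem isWeightedHomogeneous_binomial {p : (σ →₀ ℕ) × (σ →₀ ℕ)}
    (hp : valueMap a p.1 = valueMap a p.2) :
    IsWeightedHomogeneous (totalWeight a) (binomial k p)
      (Finsupp.weight (totalWeight a) p.1) := by
  refine (isWeightedHomogeneous_monomial _ _ _ rfl).sub
    (isWeightedHomogeneous_monomial _ _ _ ?_)
  rw [weight_totalWeight, weight_totalWeight, hp]

theorem weightedHomogeneousComponent_mul_self (ha : ∀ i, a i ≠ 0) {f : MvPolynomial σ k} {n : ℕ}
    (hf : IsWeightedHomogeneous (totalWeight a) f n) (r : MvPolynomial σ k) :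
    weightedHomogeneousComponent (totalWeight a) n (r * f) = C (constantCoeff r) * f := by
  classical
  induction r using MvPolynomial.induction_on' with
  | monomial d c =>
    have h1 : IsWeightedHomogeneous (totalWeight a) (monomial d c * f)
        (Finsupp.weight (totalWeight a) d + n) :=
      (isWeightedHomogeneous_monomial _ _ _ rfl).mul hf
    by_cases hd : d = 0
    · subst hd
      rw [map_zero, zero_add] at h1
      rw [h1.weightedHomogeneousComponent_same]
      simp
    · have h2 : Finsupp.weight (totalWeight a) d ≠ 0 := fun h =>
        hd (weight_totalWeight_eq_zero ha h)
      rw [h1.weightedHomogeneousComponent_ne n (by omega)]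
      simp [constantCoeff_monomial, hd]
  | add p q hp hq => rw [add_mul, map_add, hp, hq, map_add, map_add, add_mul]

attribute [local instance] MvPolynomial.weightedGradedAlgebra in
/-- If binomials of the toric ideal span it modulo `𝔪 I`, then they generate it: by Nakayama's lemma
some `r ∈ 1 + 𝔪` multiplies the ideal into their span, and a homogeneous `f` is a homogeneous
component of `r f`. -/
theorem toricKer_le_span_of_le_sup [Finite σ] (ha : ∀ i, a i ≠ 0)
    {P : Finset ((σ →₀ ℕ) × (σ →₀ ℕ))} (hP : ∀ p ∈ P, valueMap a p.1 = valueMap a p.2)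
    (hle : toricKer k a ≤ Ideal.span (binomial k '' (P : Set ((σ →₀ ℕ) × (σ →₀ ℕ)))) ⊔
      RingHom.ker (constantCoeff (R := k) (σ := σ)) * toricKer k a) :
    toricKer k a ≤ Ideal.span (binomial k '' (P : Set ((σ →₀ ℕ) × (σ →₀ ℕ)))) := by
  classical
  set J := Ideal.span (binomial k '' (P : Set ((σ →₀ ℕ) × (σ →₀ ℕ)))) with hJ
  set M := RingHom.ker (constantCoeff (R := k) (σ := σ)) with hM
  have hFG : (toricKer k a).FG := IsNoetherian.noetherian _
  obtain ⟨r, hr, hrI⟩ := Submodule.exists_sub_one_mem_and_smul_eq_zero_of_fg_of_le_smul M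
    (Submodule.map J.mkQ (toricKer k a)) (Submodule.FG.map _ hFG) (by
      rw [← Submodule.map_smul'', Ideal.smul_eq_mul]
      refine (Submodule.map_mono hle).trans ?_
      rw [Submodule.map_sup, Submodule.mkQ_map_self, bot_sup_eq])
  have hhom : J.IsHomogeneous (weightedHomogeneousSubmodule k (totalWeight a)) := by
    refine Ideal.homogeneous_span _ _ ?_
    rintro _ ⟨p, hp, rfl⟩
    exact ⟨_, isWeightedHomogeneous_binomial (hP p hp)⟩
  refine toricKer_le fun u v huv => ?_
  have h1 : r * binomial k (u, v) ∈ J := by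
    have := hrI (J.mkQ (binomial k (u, v)))
      (Submodule.mem_map_of_mem (binomial_mem_toricKer (p := (u, v)) huv))
    rw [← map_smul] at this
    exact (Submodule.Quotient.mk_eq_zero J).mp this
  have h2 := weightedHomogeneousComponent_mem_of_mem k (totalWeight a) hhom h1
    (Finsupp.weight (totalWeight a) u)
  rw [weightedHomogeneousComponent_mul_self ha (isWeightedHomogeneous_binomial (p := (u, v)) huv)]
    at h2
  rw [hM, RingHom.mem_ker, map_sub, map_one, sub_eq_zero] at hr
  simpa [hr] using h2

/-- If the toric ideal has `h` generators, then its congruence is generated by `h` pairs: among the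
binomials, a basis of `I / 𝔪 I` can be chosen. -/
theorem hasRelations_of_span [Finite σ] (ha : ∀ i, a i ≠ 0) {h : ℕ}
    {s : Finset (MvPolynomial σ k)} (hs : s.card ≤ h) (hspan : toricKer k a = Ideal.span s) :
    HasRelations (valueMap a) h := by
  classical
  set M := RingHom.ker (constantCoeff (R := k) (σ := σ)) with hM
  set π := Ideal.Quotient.mkₐ k (M * toricKer k a) with hπ
  let T : Set (MvPolynomial σ k) := binomial k '' {p | valueMap a p.1 = valueMap a p.2}
  have hTI : T ⊆ toricKer k a := by
    rintro _ ⟨p, hp, rfl⟩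
    exact binomial_mem_toricKer hp
  have hsI : (s : Set (MvPolynomial σ k)) ⊆ toricKer k a := by
    rw [hspan]; exact Ideal.subset_span
  have hspanT : toricKer k a ≤ Ideal.span T :=
    toricKer_le fun u v huv => Ideal.subset_span ⟨(u, v), huv, rfl⟩
  obtain ⟨t, htT, htspan, hli⟩ := exists_linearIndependent k (π '' T)
  have ht_le : Submodule.span k t ≤ Submodule.span k ((s.image π : Finset _) : Set _) := by
    rw [htspan, Submodule.span_le]
    rintro _ ⟨f, hf, rfl⟩
    rw [Finset.coe_image]
    exact mkQ_mem_span hsI (hspan ▸ hTI hf)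
  have : Module.Finite k (Submodule.span k ((s.image π : Finset _) : Set _)) :=
    Module.Finite.iff_fg.mpr ⟨s.image π, rfl⟩
  have : Module.Finite k (Submodule.span k t) := Submodule.finiteDimensional_of_le ht_le
  have htfin : t.Finite := by
    have hfin : Module.Finite k (Submodule.span k (Set.range (Subtype.val (p := (· ∈ t))))) := by
      rwa [Subtype.range_coe]
    have := (linearIndependent_span hli).finite
    exact t.toFinite
  obtain ⟨t, rfl⟩ := htfin.exists_finset_coe
  have htcard : t.card ≤ h := by
    rw [← finrank_span_finset_eq_card hli]
    refine (Submodule.finrank_mono ht_le).trans ?_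
    exact ((finrank_span_finset_le_card _).trans Finset.card_image_le).trans hs
  have hchoose : ∀ x ∈ t, ∃ p : (σ →₀ ℕ) × (σ →₀ ℕ),
      valueMap a p.1 = valueMap a p.2 ∧ π (binomial k p) = x := by
    intro x hx
    obtain ⟨_, ⟨p, hp, rfl⟩, h⟩ := htT hx
    exact ⟨p, hp, h⟩
  choose! c hc using hchoose
  have hP : ∀ p ∈ t.image c, valueMap a p.1 = valueMap a p.2 := by
    simp only [Finset.forall_mem_image]
    exact fun x hx => (hc x hx).1
  refine ⟨t.image c, Finset.card_image_le.trans htcard, hP, ?_⟩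
  refine rel_of_toricKer_le_span (toricKer_le_span_of_le_sup (k := k) ha hP fun f hf => ?_)
  set J := Ideal.span (binomial k '' ((t.image c : Finset _) : Set ((σ →₀ ℕ) × (σ →₀ ℕ)))) with hJ
  have h1 : π f ∈ Submodule.span k (t : Set (MvPolynomial σ k ⧸ M * toricKer k a)) := by
    rw [htspan]
    exact mkQ_mem_span hTI (hspanT hf)
  have h2 : Submodule.span k (t : Set (MvPolynomial σ k ⧸ M * toricKer k a)) ≤
      (J.restrictScalars k).map π.toLinearMap := by
    rw [Submodule.span_le]
    intro x hx
    exact ⟨binomial k (c x),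
      Ideal.subset_span ⟨c x, Finset.mem_coe.mpr (Finset.mem_image_of_mem c hx), rfl⟩, (hc x hx).2⟩
  obtain ⟨g, hg, hgf⟩ := h2 h1
  have h3 : f - g ∈ M * toricKer k a := Ideal.Quotient.eq.mp hgf.symm
  rw [← add_sub_cancel g f]
  exact Submodule.add_mem_sup hg h3

end Ideals

/-! ### The height of a toric ideal -/

section Height

variable {k : Type*} [Field k] {σ : Type*} {a : σ → Fin m → ℕ}

/-- The homomorphism that sends `x_i` to `t^(a i)` for `i ∈ D` and to an independent variable for
the other `i`. Its kernels form a chain of primes below the toric ideal. -/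
noncomputable def partialToricHom (k : Type*) [Field k] (a : σ → Fin m → ℕ) (D : Set σ) :
    MvPolynomial σ k →ₐ[k] MvPolynomial (Fin m ⊕ σ) k :=
  open Classical in
  aeval fun i => if i ∈ D then rename Sum.inl (toricHom k a (X i)) else X (Sum.inr i)

theorem partialToricHom_monomial {D : Set σ} {u : σ →₀ ℕ} (hu : ∀ i, u i ≠ 0 → i ∈ D) :
    partialToricHom k a D (monomial u 1) = rename Sum.inl (toricHom k a (monomial u 1)) := by
  classical
  rw [partialToricHom, aeval_monomial, map_one, one_mul, monomial_eq, C_1, one_mul,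
    map_finsuppProd, map_finsuppProd]
  refine Finsupp.prod_congr fun i hi => ?_
  rw [if_pos (hu i (Finsupp.mem_support_iff.mp hi)), map_pow, map_pow]

theorem ker_partialToricHom_mono {D D' : Set σ} (h : D ⊆ D') :
    RingHom.ker (partialToricHom k a D) ≤ RingHom.ker (partialToricHom k a D') := by
  classical
  let g : MvPolynomial (Fin m ⊕ σ) k →ₐ[k] MvPolynomial (Fin m ⊕ σ) k :=
    aeval (Sum.elim (fun j => X (Sum.inl j)) fun i =>
      if i ∈ D' then rename Sum.inl (toricHom k a (X i)) else X (Sum.inr i))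
  have hg : partialToricHom k a D' = g.comp (partialToricHom k a D) := by
    have hinl : ∀ p : MvPolynomial (Fin m) k, g (rename Sum.inl p) = rename Sum.inl p := by
      intro p
      have : g.comp (rename Sum.inl) = rename Sum.inl := by
        refine algHom_ext fun j => ?_
        simp [g]
      exact DFunLike.congr_fun this p
    refine algHom_ext fun i => ?_
    rw [AlgHom.comp_apply, partialToricHom, partialToricHom, aeval_X, aeval_X]
    by_cases hi : i ∈ D
    · rw [if_pos hi, if_pos (h hi), hinl]
    · rw [if_neg hi]
      simp [g]
  intro f hf
  rw [RingHom.mem_ker] at hf ⊢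
  rw [hg, AlgHom.comp_apply, hf, map_zero]

theorem ker_partialToricHom_univ :
    RingHom.ker (partialToricHom k a Set.univ) = toricKer k a := by
  have h : partialToricHom k a Set.univ = (rename Sum.inl).comp (toricHom k a) := by
    refine algHom_ext fun i => ?_
    rw [X, partialToricHom_monomial (by simp)]
    rfl
  ext f
  rw [toricKer, RingHom.mem_ker, RingHom.mem_ker, h, AlgHom.comp_apply,
    map_eq_zero_iff _ (rename_injective _ Sum.inl_injective)]

/-- If the elements of `N` have multiples in the semigroup of the other elements, then the height of
the toric ideal is at least `#N`. -/
theorem card_le_height_toricKer {N : Finset σ}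
    (hN : ∀ i ∈ N, ∃ n : ℕ, 0 < n ∧ ∃ e : σ →₀ ℕ, valueMap a e = n • a i ∧
      ∀ j, e j ≠ 0 → j ∉ N) : (N.card : ℕ∞) ≤ (toricKer k a).height := by
  classical
  have key : ∀ T : Finset σ, T ⊆ N →
      (T.card : ℕ∞) ≤ (RingHom.ker (partialToricHom k a {i | i ∈ N → i ∈ T})).height := by
    intro T
    induction T using Finset.induction_on with
    | empty => simp
    | insert b T hb ih =>
      intro hT
      have hbN : b ∈ N := hT (Finset.mem_insert_self b T)
      have h1 := ih ((Finset.subset_insert b T).trans hT)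
      obtain ⟨n, hn, e, he, heN⟩ := hN b hbN
      have hprime : ∀ D : Set σ, (RingHom.ker (partialToricHom k a D)).IsPrime := fun D =>
        RingHom.ker_isPrime _
      have := hprime {i | i ∈ N → i ∈ T}
      have := hprime {i | i ∈ N → i ∈ insert b T}
      have hlt : RingHom.ker (partialToricHom k a {i | i ∈ N → i ∈ T}) <
          RingHom.ker (partialToricHom k a {i | i ∈ N → i ∈ insert b T}) := by
        refine lt_of_le_of_ne (ker_partialToricHom_mono fun i hi hiN =>
          Finset.mem_insert_of_mem (hi hiN)) fun heq => ?_
        have hmem : binomial k (Finsupp.single b n, e) ∈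
            RingHom.ker (partialToricHom k a {i | i ∈ N → i ∈ insert b T}) := by
          rw [RingHom.mem_ker, binomial, map_sub, partialToricHom_monomial,
            partialToricHom_monomial, ← map_sub, ← map_sub]
          · have : binomial k (Finsupp.single b n, e) ∈ toricKer k a :=
              binomial_mem_toricKer (by simp [he])
            rw [toricKer, RingHom.mem_ker, binomial] at this
            rw [this, map_zero]
          · exact fun i hi hiN => absurd hiN (heN i hi)
          · intro i hi _
            have : i = b := by
              by_contra hne
              exact hi (Finsupp.single_eq_of_ne hne)
            rw [this]
            exact Finset.mem_insert_self b T
        rw [← heq, RingHom.mem_ker, binomial, map_sub,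
          partialToricHom_monomial (D := {i | i ∈ N → i ∈ T}) (u := e)
          fun i hi hiN => absurd hiN (heN i hi)] at hmem
        -- Specialize the variables `t_j` to `1` and the independent variables to `0`.
        have h2 := congrArg (eval (Sum.elim (fun _ => 1) fun _ => 0)) hmem
        have hbT : ¬ (b ∈ N → b ∈ T) := fun h => hb (h hbN)
        have h3 : partialToricHom k a {i | i ∈ N → i ∈ T} (monomial (Finsupp.single b n) 1) =
            X (Sum.inr b) ^ n := by
          rw [← X_pow_eq_monomial, map_pow, partialToricHom, aeval_X, if_neg (by exact hbT)]
        rw [h3, toricHom_monomial, map_sub, eval_rename, map_pow, eval_X, eval_monomial] at h2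
        simp [hn.ne', Finsupp.prod] at h2
      have h4 := Ideal.height_add_one_le_of_lt_of_isPrime hlt
      rw [Finset.card_insert_of_notMem hb, Nat.cast_add, Nat.cast_one]
      exact (add_le_add_left h1 1).trans h4
  have h := key N subset_rfl
  rwa [show {i : σ | i ∈ N → i ∈ N} = Set.univ by ext; simp, ker_partialToricHom_univ] at h

/-- The endomorphism of `k[t]` that sets the variables of `T` to zero. -/
noncomputable def killVars (k : Type*) [Field k] (T : Finset (Fin m)) :
    MvPolynomial (Fin m) k →ₐ[k] MvPolynomial (Fin m) k :=
  aeval fun j => if j ∈ T then 0 else X j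

theorem killVars_comp {T T' : Finset (Fin m)} (h : T ⊆ T') :
    (killVars k T').comp (killVars k T) = killVars k T' := by
  refine algHom_ext fun j => ?_
  rw [AlgHom.comp_apply, killVars, killVars, aeval_X, aeval_X]
  by_cases hj : j ∈ T
  · rw [if_pos hj, if_pos (h hj), map_zero]
  · rw [if_neg hj, aeval_X]

/-- If the vectors contain a multiple of each coordinate vector, then setting the `t_j` to zero one
after another gives a chain of primes of length `m` above the toric ideal. -/
theorem height_toricKer_add_le [Finite σ]
    (hsingle : ∀ j, ∃ i, ∃ d, 0 < d ∧ a i = Pi.single j d) :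
    (toricKer k a).height + m ≤ Nat.card σ := by
  classical
  have key : ∀ T : Finset (Fin m), (toricKer k a).height + T.card ≤
      (RingHom.ker ((killVars k T).comp (toricHom k a))).height := by
    intro T
    induction T using Finset.induction_on with
    | empty =>
      rw [Finset.card_empty, Nat.cast_zero, add_zero]
      refine Ideal.height_mono fun f hf => ?_
      rw [toricKer, RingHom.mem_ker] at hf
      rw [RingHom.mem_ker, AlgHom.comp_apply, hf, map_zero]
    | insert j T hj ih =>
      have hprime : ∀ T : Finset (Fin m),
          (RingHom.ker ((killVars k T).comp (toricHom k a))).IsPrime := fun T =>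
        RingHom.ker_isPrime _
      have := hprime T
      have := hprime (insert j T)
      have hlt : RingHom.ker ((killVars k T).comp (toricHom k a)) <
          RingHom.ker ((killVars k (insert j T)).comp (toricHom k a)) := by
        refine lt_of_le_of_ne (fun f hf => ?_) fun heq => ?_
        · rw [RingHom.mem_ker, AlgHom.comp_apply] at hf ⊢
          rw [← killVars_comp (Finset.subset_insert j T), AlgHom.comp_apply, hf, map_zero]
        · obtain ⟨i, d, hd, hi⟩ := hsingle j
          have hX : toricHom k a (X i) = X j ^ d := by
            rw [toricHom, aeval_X, hi, Finset.prod_eq_single j]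
            · rw [Pi.single_eq_same]
            · intro l _ hl
              rw [Pi.single_eq_of_ne hl, pow_zero]
            · simp
          have hmem : (X i : MvPolynomial σ k) ∈
              RingHom.ker ((killVars k (insert j T)).comp (toricHom k a)) := by
            rw [RingHom.mem_ker, AlgHom.comp_apply, hX, map_pow, killVars, aeval_X,
              if_pos (Finset.mem_insert_self j T), zero_pow hd.ne']
          rw [← heq, RingHom.mem_ker, AlgHom.comp_apply, hX, map_pow, killVars, aeval_X,
            if_neg hj] at hmem
          exact pow_ne_zero d (X_ne_zero j) hmem
      have h4 := Ideal.height_add_one_le_of_lt_of_isPrime hlt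
      rw [Finset.card_insert_of_notMem hj, Nat.cast_add, Nat.cast_one, ← add_assoc]
      exact (add_le_add_left ih 1).trans h4
  have h := key Finset.univ
  rw [Finset.card_univ, Fintype.card_fin] at h
  have hprime : (RingHom.ker ((killVars k Finset.univ).comp (toricHom k a))).IsPrime :=
    RingHom.ker_isPrime _
  have h2 := Ideal.height_le_ringKrullDim_of_ne_top hprime.ne_top
  rw [MvPolynomial.ringKrullDim_of_isNoetherianRing, ringKrullDim_eq_zero_of_field, zero_add] at h2
  exact h.trans (by exact_mod_cast h2)

end Height

/-! ### Complete intersections with vectors on different rays -/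

theorem exists_subset_forall_exists_eq {α : Type*} [DecidableEq α] (f : α → α) :
    ∀ N : Finset α, N.Nonempty → (∀ b ∈ N, f b ∈ N) →
      ∃ C ⊆ N, C.Nonempty ∧ ∀ i ∈ C, ∃ j ∈ C, f j = i := by
  intro N
  induction N using Finset.strongInduction with
  | H N ih =>
    intro hN hf
    have hsub : N.image f ⊆ N := Finset.image_subset_iff.mpr hf
    by_cases heq : N.image f = N
    · exact ⟨N, subset_rfl, hN, fun i hi => Finset.mem_image.mp (heq.symm ▸ hi)⟩
    · obtain ⟨C, hC, hC'⟩ := ih _ (lt_of_le_of_ne hsub heq) (hN.image f) fun b hb =>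
        Finset.mem_image_of_mem f (hsub hb)
      exact ⟨C, hC.trans hsub, hC'⟩

section DistinctRays

variable {σ : Type*} {a : σ → Fin m → ℕ}

/-- Let the congruence be generated by at most `#N` pairs, where each `b ∈ N` has a multiple in the
semigroup of the elements outside `N`, and suppose that the vectors lie on different rays. Then the
generating pairs are indexed by `N`, and one side of the pair of `b` is a multiple of `b`. -/
theorem exists_pairs_indexed {N : Finset σ} (ha : ∀ i, a i ≠ 0)
    (hray : ∀ i j (p q : ℕ), 0 < p → p • a i = q • a j → i = j)
    (hN : ∀ i ∈ N, ∃ n : ℕ, 0 < n ∧ ∃ e : σ →₀ ℕ, valueMap a e = n • a i ∧ ∀ j, e j ≠ 0 → j ∉ N)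
    {P : Finset ((σ →₀ ℕ) × (σ →₀ ℕ))} (hc : P.card ≤ N.card)
    (hP : ∀ p ∈ P, valueMap a p.1 = valueMap a p.2)
    (hgen : ∀ C : AddCon (σ →₀ ℕ), (∀ p ∈ P, C p.1 p.2) →
      ∀ u v, valueMap a u = valueMap a v → C u v) :
    ∃ x y : σ → σ →₀ ℕ, (∀ p ∈ P, ∃ b ∈ N, p = (x b, y b) ∨ p = (y b, x b)) ∧
      ∀ b ∈ N, x b b ≠ 0 ∧ (∀ j, j ≠ b → x b j = 0) ∧ y b ≠ 0 ∧
        valueMap a (x b) = valueMap a (y b) := by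
  classical
  have hex : ∀ b ∈ N, ∃ p ∈ P, ∃ x y : σ →₀ ℕ, (p = (x, y) ∨ p = (y, x)) ∧ x ≠ y ∧
      ∀ j, j ≠ b → x j = 0 := by
    intro b hb
    obtain ⟨n, hn, e, he, heN⟩ := hN b hb
    obtain ⟨⟨u, v⟩, hp, hne, h⟩ := exists_pair_meeting (T := {u : σ →₀ ℕ | ∀ j, j ≠ b → u j = 0})
      (fun u v huv => by
        refine ⟨fun j hj => ?_, fun j hj => ?_⟩ <;>
        · have := huv j hj
          rw [Finsupp.add_apply] at this
          omega)
      hgen (u := Finsupp.single b n) (v := e) (by simp [he])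
      (by
        rintro rfl
        exact heN b (by simp [hn.ne']) hb)
      (fun j hj => Finsupp.single_eq_of_ne hj)
    rcases h with h | h
    · exact ⟨_, hp, u, v, Or.inl rfl, hne, h⟩
    · exact ⟨_, hp, v, u, Or.inr rfl, hne.symm, h⟩
  choose! π hπP x y hπ hxy hx using hex
  have hval : ∀ b ∈ N, valueMap a (x b) = valueMap a (y b) := by
    intro b hb
    have h := hP _ (hπP b hb)
    rcases hπ b hb with h' | h' <;> rw [h'] at h
    · exact h
    · exact h.symm
  have hx0 : ∀ b ∈ N, x b ≠ 0 := by
    intro b hb h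
    have h1 := hval b hb
    rw [h, map_zero] at h1
    exact hxy b hb (h.trans (eq_zero_of_valueMap_eq_zero ha h1.symm).symm)
  have hxsingle : ∀ b ∈ N, x b = Finsupp.single b (x b b) := by
    intro b hb
    ext j
    by_cases hj : j = b
    · subst hj; simp
    · rw [hx b hb j hj, Finsupp.single_eq_of_ne hj]
  have hxb : ∀ b ∈ N, x b b ≠ 0 := by
    intro b hb h
    refine hx0 b hb ?_
    rw [hxsingle b hb, h, Finsupp.single_zero]
  have hinj : ∀ b ∈ N, ∀ b' ∈ N, π b = π b' → b = b' := by
    intro b hb b' hb' h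
    have h1 : x b = x b' ∨ x b = y b' := by
      rcases hπ b hb with h2 | h2 <;> rcases hπ b' hb' with h3 | h3 <;>
        rw [h2, h3, Prod.mk.injEq] at h
      · exact Or.inl h.1
      · exact Or.inr h.1
      · exact Or.inr h.2
      · exact Or.inl h.2
    have h2 : valueMap a (x b) = valueMap a (x b') := by
      rcases h1 with h1 | h1
      · rw [h1]
      · rw [h1, hval b' hb']
    rw [hxsingle b hb, hxsingle b' hb', valueMap_single, valueMap_single] at h2
    exact hray _ _ _ _ (Nat.pos_of_ne_zero (hxb b hb)) h2
  have hsurj : N.image π = P := by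
    refine Finset.eq_of_subset_of_card_le (Finset.image_subset_iff.mpr hπP) ?_
    rwa [Finset.card_image_of_injOn fun b hb b' hb' h => hinj b hb b' hb' h]
  refine ⟨x, y, fun p hp => ?_, fun b hb => ⟨hxb b hb, hx b hb, fun h => ?_, hval b hb⟩⟩
  · rw [← hsurj, Finset.mem_image] at hp
    obtain ⟨b, hb, rfl⟩ := hp
    exact ⟨b, hb, hπ b hb⟩
  · have h1 := hval b hb
    rw [h, map_zero] at h1
    exact hx0 b hb (eq_zero_of_valueMap_eq_zero ha h1)

/-- In the situation of `exists_pairs_indexed` some `b ∈ N` occurs in none of the sides `y b'`.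
Otherwise the toric ideal lies in an ideal with `#N` generators of which some are variables, and so
its height is less than `#N`. -/
theorem exists_forall_apply_eq_zero (k : Type*) [Field k] [Finite σ] {N : Finset σ}
    (hNne : N.Nonempty)
    (hN : ∀ i ∈ N, ∃ n : ℕ, 0 < n ∧ ∃ e : σ →₀ ℕ, valueMap a e = n • a i ∧ ∀ j, e j ≠ 0 → j ∉ N)
    {P : Finset ((σ →₀ ℕ) × (σ →₀ ℕ))}
    (hP : ∀ p ∈ P, valueMap a p.1 = valueMap a p.2)
    (hgen : ∀ C : AddCon (σ →₀ ℕ), (∀ p ∈ P, C p.1 p.2) →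
      ∀ u v, valueMap a u = valueMap a v → C u v)
    {x y : σ → σ →₀ ℕ} (hxy : ∀ p ∈ P, ∃ b ∈ N, p = (x b, y b) ∨ p = (y b, x b))
    (hx : ∀ b ∈ N, x b b ≠ 0) (hy : ∀ b ∈ N, y b ≠ 0) :
    ∃ b ∈ N, ∀ b' ∈ N, y b' b = 0 := by
  classical
  by_contra! hcon
  choose! f hfN hf using hcon
  obtain ⟨C, hCN, hCne, hC⟩ := exists_subset_forall_exists_eq f N hNne hfN
  let G : Finset (MvPolynomial σ k) :=
    C.image X ∪ (N \ C).image fun b => binomial k (x b, y b)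
  have hGcard : G.card ≤ N.card := by
    refine (Finset.card_union_le _ _).trans ?_
    rw [← Finset.card_sdiff_add_card_eq_card hCN, add_comm]
    exact add_le_add Finset.card_image_le Finset.card_image_le
  have hXmem : ∀ b ∈ C, (X b : MvPolynomial σ k) ∈ Ideal.span (G : Set (MvPolynomial σ k)) :=
    fun b hb => Ideal.subset_span
      (Finset.mem_coe.mpr (Finset.mem_union_left _ (Finset.mem_image_of_mem _ hb)))
  have hmonomial : ∀ b ∈ C, ∀ u : σ →₀ ℕ, u b ≠ 0 →
      (monomial u 1 : MvPolynomial σ k) ∈ Ideal.span (G : Set (MvPolynomial σ k)) :=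
    fun b hb u hu => Ideal.mem_of_dvd _ (X_dvd_monomial.mpr (Or.inr hu)) (hXmem b hb)
  have hbin : ∀ b ∈ N, binomial k (x b, y b) ∈ Ideal.span (G : Set (MvPolynomial σ k)) := by
    intro b hb
    by_cases hbC : b ∈ C
    · obtain ⟨j, hj, rfl⟩ := hC b hbC
      exact sub_mem (hmonomial _ hbC _ (hx _ hb)) (hmonomial j hj _ (hf j (hCN hj)))
    · exact Ideal.subset_span (Finset.mem_coe.mpr (Finset.mem_union_right _
        (Finset.mem_image_of_mem (fun b => binomial k (x b, y b))
          (Finset.mem_sdiff.mpr ⟨hb, hbC⟩))))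
  have hle : toricKer k a ≤ Ideal.span (G : Set (MvPolynomial σ k)) := by
    rw [toricKer_eq_span hP hgen, Ideal.span_le]
    rintro _ ⟨p, hp, rfl⟩
    obtain ⟨b, hb, rfl | rfl⟩ := hxy p hp
    · exact hbin b hb
    · have := neg_mem (hbin b hb)
      simpa [binomial] using this
  have hne : Ideal.span (G : Set (MvPolynomial σ k)) ≠ ⊤ := by
    refine ne_top_of_le_ne_top (RingHom.ker_ne_top (constantCoeff (R := k) (σ := σ))) ?_
    rw [Ideal.span_le]
    intro g hg
    rw [Finset.mem_coe, Finset.mem_union, Finset.mem_image, Finset.mem_image] at hg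
    rw [SetLike.mem_coe, RingHom.mem_ker]
    rcases hg with ⟨b, -, rfl⟩ | ⟨b, hb, rfl⟩
    · simp
    · have hb := (Finset.mem_sdiff.mp hb).1
      have hxb : x b ≠ 0 := by
        intro h
        exact hx b hb (by rw [h]; rfl)
      rw [binomial, map_sub, constantCoeff_monomial, constantCoeff_monomial, if_neg hxb,
        if_neg (hy b hb), sub_zero]
  obtain ⟨p, hp⟩ := Ideal.nonempty_minimalPrimes hne
  have hprime : p.IsPrime := hp.1.1
  have hlt : toricKer k a < p := by
    refine lt_of_le_of_ne (hle.trans hp.1.2) fun heq => ?_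
    obtain ⟨b, hb⟩ := hCne
    exact X_notMem_toricKer (k := k) (a := a) b (heq ▸ hp.1.2 (hXmem b hb))
  have h1 := Ideal.height_add_one_le_of_lt_of_isPrime hlt
  have h2 := Ideal.height_le_card_of_mem_minimalPrimes_span_finset hp
  have h3 := card_le_height_toricKer (k := k) hN
  have h4 : ((N.card + 1 : ℕ) : ℕ∞) ≤ N.card := by
    rw [Nat.cast_add, Nat.cast_one]
    exact (add_le_add_left h3 1).trans (h1.trans (h2.trans (by exact_mod_cast hGcard)))
  have h5 : N.card + 1 ≤ N.card := by exact_mod_cast h4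
  omega

/-- If the congruence of a family of vectors on different rays is generated by at most `#N` pairs,
then some `b ∈ N` has a multiple `c b` in the semigroup of the other elements such that `c` divides
all differences of exponents of `b` in relations. -/
theorem exists_multiple_of_hasRelations (k : Type*) [Field k] [Finite σ] {N : Finset σ}
    (ha : ∀ i, a i ≠ 0) (hray : ∀ i j (p q : ℕ), 0 < p → p • a i = q • a j → i = j)
    (hNne : N.Nonempty)
    (hN : ∀ i ∈ N, ∃ n : ℕ, 0 < n ∧ ∃ e : σ →₀ ℕ, valueMap a e = n • a i ∧ ∀ j, e j ≠ 0 → j ∉ N)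
    (H : HasRelations (valueMap a) N.card) :
    ∃ b ∈ N, ∃ (c : ℕ) (w : σ →₀ ℕ), valueMap a w = c • a b ∧ w b = 0 ∧
      ∀ u v, valueMap a u = valueMap a v → u b ≡ v b [MOD c] := by
  obtain ⟨P, hc, hP, hgen⟩ := H
  obtain ⟨x, y, hxy, hN'⟩ := exists_pairs_indexed ha hray hN hc hP hgen
  obtain ⟨b, hb, hyb⟩ := exists_forall_apply_eq_zero k hNne hN hP hgen hxy
    (fun b hb => (hN' b hb).1) fun b hb => (hN' b hb).2.2.1
  refine ⟨b, hb, x b b, y b, ?_, hyb b hb, fun u v huv => ?_⟩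
  · rw [← (hN' b hb).2.2.2, ← valueMap_single]
    congr 1
    ext j
    by_cases hj : j = b
    · subst hj; simp
    · rw [(hN' b hb).2.1 j hj, Finsupp.single_eq_of_ne hj]
  · let D : AddCon (σ →₀ ℕ) :=
      { r := fun u v => u b ≡ v b [MOD x b b]
        iseqv := ⟨fun u => Nat.ModEq.refl _, Nat.ModEq.symm, Nat.ModEq.trans⟩
        add' := fun h h' => Nat.ModEq.add h h' }
    have hD : ∀ b' ∈ N, D (x b') (y b') := by
      intro b' hb'
      change x b' b ≡ y b' b [MOD x b b]
      rw [hyb b' hb']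
      by_cases h : b = b'
      · subst h
        exact Nat.modEq_zero_iff_dvd.mpr dvd_rfl
      · rw [(hN' b' hb').2.1 b h]
    refine hgen D (fun p hp => ?_) u v huv
    obtain ⟨b', hb', rfl | rfl⟩ := hxy p hp
    · exact hD b' hb'
    · exact D.symm (hD b' hb')

end DistinctRays

/-- The elements off the axes, as a subset of the index type of the variables. -/
noncomputable def offAxesIndices (S : Finset (Fin m → ℕ)) : Finset S :=
  S.attach.filter fun i => (i : Fin m → ℕ) ∈ offAxes S

theorem mem_offAxesIndices {S : Finset (Fin m → ℕ)} {i : S} :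
    i ∈ offAxesIndices S ↔ (i : Fin m → ℕ) ∈ offAxes S := by
  simp [offAxesIndices]

theorem card_offAxesIndices {S : Finset (Fin m → ℕ)} :
    (offAxesIndices S).card = (offAxes S).card := by
  refine Finset.card_bij (fun i _ => (i : Fin m → ℕ)) (fun i hi => mem_offAxesIndices.mp hi)
    (fun i _ j _ h => Subtype.ext h) fun b hb => ?_
  exact ⟨⟨b, (mem_offAxes.mp hb).1⟩, mem_offAxesIndices.mpr hb, rfl⟩

namespace IsSimplicialRays

variable {S : Finset (Fin m → ℕ)}

theorem exists_nsmul_mem_natSpan (hS : IsSimplicialRays S) {a : Fin m → ℕ} (ha : a ∈ S) :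
    ∃ n : ℕ, 0 < n ∧ n • a ∈ natSpan (S \ offAxes S) := by
  classical
  rw [← Finset.univ_sum_single a]
  refine Finset.sum_induction _ (fun x => ∃ n : ℕ, 0 < n ∧ n • x ∈ natSpan (S \ offAxes S)) ?_ ?_ ?_
  · rintro x y ⟨n, hn, hx⟩ ⟨n', hn', hy⟩
    refine ⟨n * n', Nat.mul_pos hn hn', ?_⟩
    rw [smul_add, mul_nsmul x, mul_nsmul' y]
    exact add_mem (nsmul_mem hx _) (nsmul_mem hy _)
  · exact ⟨1, one_pos, by simp⟩
  · intro j _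
    by_cases hj : a j = 0
    · exact ⟨1, one_pos, by simp [hj]⟩
    · obtain ⟨p, hp, hmem⟩ := hS.single_mem a ha j hj
      refine ⟨p, hp, ?_⟩
      have h1 : p • (Pi.single j (a j) : Fin m → ℕ) = a j • Pi.single j p := by
        rw [← Pi.single_smul, ← Pi.single_smul, smul_eq_mul, smul_eq_mul, mul_comm]
      rw [h1]
      refine nsmul_mem (AddSubmonoid.subset_closure ?_) _
      rw [Finset.mem_coe, Finset.mem_sdiff, mem_offAxes]
      exact ⟨hmem, fun h => h.2 j p rfl⟩

theorem exists_nsmul_eq_valueMap (hS : IsSimplicialRays S) (i : S) :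
    ∃ n : ℕ, 0 < n ∧ ∃ e : S →₀ ℕ, valueMap ((↑) : S → Fin m → ℕ) e = n • (i : Fin m → ℕ) ∧
      ∀ j, e j ≠ 0 → j ∉ offAxesIndices S := by
  classical
  obtain ⟨n, hn, hmem⟩ := hS.exists_nsmul_mem_natSpan i.2
  obtain ⟨e, he, he'⟩ := exists_valueMap_eq_of_mem_natSpan Finset.sdiff_subset hmem
  refine ⟨n, hn, e, he, fun j hj h => ?_⟩
  exact (Finset.mem_sdiff.mp (he' j hj)).2 (mem_offAxesIndices.mp h)

/-- If every element is a rational combination of the others, then not all elements lie on the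
coordinate axes. -/
theorem offAxes_nonempty (hS : IsSimplicialRays S) (hne : S.Nonempty)
    (hrat : ∀ a ∈ S, toRat a ∈ ratSpan (S.erase a)) : (offAxes S).Nonempty := by
  by_contra hemp
  rw [Finset.not_nonempty_iff_eq_empty] at hemp
  have hsingle : ∀ a ∈ S, ∃ (j : Fin m) (p : ℕ), a = Pi.single j p := by
    intro a ha
    by_contra! hcon
    have : a ∈ offAxes S := mem_offAxes.mpr ⟨ha, hcon⟩
    rw [hemp] at this
    simp at this
  obtain ⟨a, ha⟩ := hne
  obtain ⟨j, p, rfl⟩ := hsingle a ha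
  have hp : p ≠ 0 := by
    rintro rfl
    exact hS.ne_zero _ ha (by simp)
  have hle : ratSpan (S.erase (Pi.single j p)) ≤
      LinearMap.ker (LinearMap.proj j : (Fin m → ℚ) →ₗ[ℚ] ℚ) := by
    refine Submodule.span_le.mpr ?_
    rintro _ ⟨c, hc, rfl⟩
    rw [Finset.mem_coe, Finset.mem_erase] at hc
    obtain ⟨i, q, rfl⟩ := hsingle c hc.2
    by_cases hij : i = j
    · subst hij
      refine absurd (hS.eq_of_nsmul_eq _ hc.2 _ ha p q (Nat.pos_of_ne_zero hp) ?_) hc.1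
      rw [← Pi.single_smul, ← Pi.single_smul, smul_eq_mul, smul_eq_mul, mul_comm]
    · simp [toRat, Pi.single_eq_of_ne (Ne.symm hij)]
  have h1 := hle (hrat _ ha)
  simp [toRat, hp] at h1

end IsSimplicialRays

theorem exists_add_eq_of_mem_intSpan {T : Finset (Fin m → ℕ)} {b : Fin m → ℕ}
    (hb : toInt b ∈ intSpan T) : ∃ u ∈ natSpan T, ∃ v ∈ natSpan T, b + v = u := by
  have key : ∀ z ∈ intSpan T, ∃ u ∈ natSpan T, ∃ v ∈ natSpan T, z + toInt v = toInt u := by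
    intro z hz
    induction hz using AddSubgroup.closure_induction with
    | mem z hz =>
      obtain ⟨s, hs, rfl⟩ := hz
      exact ⟨s, AddSubmonoid.subset_closure hs, 0, zero_mem _, by ext; simp [toInt]⟩
    | zero => exact ⟨0, zero_mem _, 0, zero_mem _, by simp⟩
    | add z z' _ _ h h' =>
      obtain ⟨u, hu, v, hv, h⟩ := h
      obtain ⟨u', hu', v', hv', h'⟩ := h'
      refine ⟨u + u', add_mem hu hu', v + v', add_mem hv hv', ?_⟩
      rw [toInt_add, toInt_add, ← h, ← h']
      abel
    | neg z _ h =>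
      obtain ⟨u, hu, v, hv, h⟩ := h
      refine ⟨v, hv, u, hu, ?_⟩
      rw [← h]
      abel
  obtain ⟨u, hu, v, hv, h⟩ := key _ hb
  refine ⟨u, hu, v, hv, ?_⟩
  ext j
  have := congrFun h j
  simp only [toInt, Pi.add_apply] at this ⊢
  exact_mod_cast this

/-- A nonempty set that no reduction step changes has too many relations. -/
theorem IsSimplicialRays.not_setHasRelations {R : Finset (Fin m → ℕ)} (hR : IsSimplicialRays R)
    (hne : R.Nonempty) (hstable : ∀ a ∈ R, reduceStep R a = R) :
    ¬ SetHasRelations R (offAxes R).card := by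
  classical
  intro H
  have hoff := hR.offAxes_nonempty hne fun a ha => (mem_of_reduceStep_eq ha (hstable a ha)).1
  rw [← card_offAxesIndices] at H
  obtain ⟨b, -, c, w, hw, hwb, hmod⟩ := exists_multiple_of_hasRelations ℚ
    (fun i => hR.ne_zero _ i.2)
    (fun i j p q hp h => Subtype.ext (hR.eq_of_nsmul_eq _ i.2 _ j.2 p q hp h))
    (by rw [← Finset.card_pos, card_offAxesIndices]; exact hoff.card_pos)
    (fun i _ => hR.exists_nsmul_eq_valueMap i) H
  obtain ⟨-, hint, hnat⟩ := mem_of_reduceStep_eq b.2 (hstable b b.2)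
  obtain ⟨u, hu, v, hv, huv⟩ := exists_add_eq_of_mem_intSpan hint
  obtain ⟨e, rfl, he⟩ := exists_valueMap_eq_of_mem_natSpan (Finset.erase_subset _ R) hu
  obtain ⟨f, rfl, hf⟩ := exists_valueMap_eq_of_mem_natSpan (Finset.erase_subset _ R) hv
  have hzero : ∀ e : R →₀ ℕ, (∀ i, e i ≠ 0 → (i : Fin m → ℕ) ∈ R.erase (b : Fin m → ℕ)) →
      e b = 0 := by
    intro e he
    by_contra h
    exact Finset.notMem_erase _ _ (he b h)
  have h1 := hmod (Finsupp.single b 1 + f) e (by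
    rw [map_add, valueMap_single, one_smul]
    exact huv)
  rw [Finsupp.add_apply, Finsupp.single_eq_same, hzero e he, hzero f hf, add_zero] at h1
  have hc1 : c = 1 := Nat.dvd_one.mp (Nat.modEq_zero_iff_dvd.mp h1)
  apply hnat
  rw [hc1, one_smul] at hw
  rw [← hw]
  refine valueMap_mem_natSpan fun i hi => Finset.mem_erase.mpr ⟨fun h => hi ?_, i.2⟩
  rw [Subtype.ext (h.trans hw), hwb]

theorem setHasRelations_empty (h : ℕ) : SetHasRelations (∅ : Finset (Fin m → ℕ)) h :=
  ⟨∅, by simp, by simp, fun C _ u v _ => by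
    rw [Subsingleton.elim u v]
    exact C.refl v⟩

/-! ### Simplicial projective toric ideals -/

namespace IsSimplicialProjective

variable {A : Finset (Fin m → ℕ)}

theorem isSimplicialRays (hA : IsSimplicialProjective A) : IsSimplicialRays A := by
  obtain ⟨d, hS, hd⟩ := hA
  refine ⟨fun a ha h => hS.zero_notMem (h ▸ ha), fun a ha b hb p q hp h => ?_,
    fun a ha j _ => ⟨d, hS.pos j, hS.single_mem j⟩⟩
  have hd0 : d ≠ 0 := by
    intro hd0
    have h1 := hd a ha
    rw [hd0, Finset.sum_eq_zero_iff] at h1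
    refine hS.zero_notMem ?_
    rwa [show a = 0 from funext fun j => h1 j (Finset.mem_univ j)] at ha
  -- Both vectors have coordinate sum `d`, so the two multiples are the same.
  have hpq : p = q := by
    have h1 : ∑ j, (p • a) j = ∑ j, (q • b) j := by rw [h]
    simp only [Pi.smul_apply, smul_eq_mul, ← Finset.mul_sum, hd a ha, hd b hb] at h1
    exact Nat.eq_of_mul_eq_mul_right (Nat.pos_of_ne_zero hd0) h1
  subst hpq
  ext j
  have := congrFun h j
  simp only [Pi.smul_apply, smul_eq_mul] at this
  exact Nat.eq_of_mul_eq_mul_left hp this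

theorem card_offAxes_add (hA : IsSimplicialProjective A) : (offAxes A).card + m = A.card := by
  classical
  obtain ⟨d, hS, hd⟩ := hA
  have h1 : A \ offAxes A = Finset.univ.image fun j : Fin m => (Pi.single j d : Fin m → ℕ) := by
    ext a
    rw [Finset.mem_sdiff, mem_offAxes, Finset.mem_image]
    constructor
    · rintro ⟨ha, h⟩
      have h2 : ∃ (j : Fin m) (p : ℕ), a = Pi.single j p := by
        by_contra! hcon
        exact h ⟨ha, hcon⟩
      obtain ⟨j, p, rfl⟩ := h2
      have h3 := hd _ ha
      rw [Finset.sum_pi_single'] at h3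
      rw [if_pos (Finset.mem_univ j)] at h3
      exact ⟨j, Finset.mem_univ j, by rw [h3]⟩
    · rintro ⟨j, -, rfl⟩
      exact ⟨hS.single_mem j, fun h => h.2 j d rfl⟩
  have h2 : (A \ offAxes A).card = m := by
    rw [h1, Finset.card_image_of_injective, Finset.card_univ, Fintype.card_fin]
    intro i j hij
    by_contra hne
    have := congrFun hij i
    simp only [Pi.single_eq_same, Pi.single_eq_of_ne hne] at this
    exact (hS.pos i).ne' this
  have h3 : offAxes A ⊆ A := fun a ha => (mem_offAxes.mp ha).1
  have := Finset.card_sdiff_add_card_eq_card h3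
  omega

theorem height_toricIdeal (k : Type*) [Field k] (hA : IsSimplicialProjective A) :
    (toricIdeal k A).height = (offAxes A).card := by
  rw [toricIdeal_eq_toricKer]
  refine le_antisymm ?_ ?_
  · have hcard := hA.card_offAxes_add
    obtain ⟨d, hS, hd⟩ := hA
    have h := height_toricKer_add_le (k := k) (a := ((↑) : A → Fin m → ℕ)) fun j =>
      ⟨⟨_, hS.single_mem j⟩, d, hS.pos j, rfl⟩
    rw [Nat.card_eq_fintype_card, Fintype.card_coe, ← hcard, Nat.cast_add] at h
    exact (WithTop.add_le_add_iff_right (ENat.natCast_ne_top m)).mp h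
  · rw [← card_offAxesIndices]
    exact card_le_height_toricKer fun i _ => hA.isSimplicialRays.exists_nsmul_eq_valueMap i

/-- A simplicial projective toric ideal is a complete intersection if and only if its congruence is
generated by as many pairs as there are vectors off the coordinate axes. -/
theorem isCompleteIntersection_iff (k : Type*) [Field k] (hA : IsSimplicialProjective A) :
    IsCompleteIntersection (toricIdeal k A) ↔ SetHasRelations A (offAxes A).card := by
  have hheight := hA.height_toricIdeal k
  have hfg : (toricIdeal k A).FG := IsNoetherian.noetherian _
  constructor
  · rintro ⟨-, h⟩
    rw [hheight, Nat.cast_inj] at h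
    obtain ⟨s, hs, hspan⟩ :=
      Submodule.FG.exists_span_finset_card_eq_spanFinrank hfg
    exact hasRelations_of_span (k := k) (fun i => hA.isSimplicialRays.ne_zero _ i.2)
      (hs.trans h).le hspan.symm
  · intro H
    refine ⟨hfg, le_antisymm ?_ ?_⟩
    · obtain ⟨s, hs, hspan⟩ := exists_finset_span_of_hasRelations (k := k) H
      rw [hheight, toricIdeal_eq_toricKer, hspan]
      have h1 := Submodule.spanFinrank_span_le_ncard_of_finite (R := MvPolynomial A k)
        s.finite_toSet
      rw [Set.ncard_coe_finset] at h1
      exact_mod_cast h1.trans hs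
    · exact Ideal.height_le_spanFinrank _ (toricKer_isPrime (k := k)).ne_top

end IsSimplicialProjective

end ToricReduction

theorem corollary3p3 {k : Type*} [Field k] {m : ℕ} (A : Finset (Fin m → ℕ))
    (hA : ToricReduction.IsSimplicialProjective A) :
    ToricReduction.ReductionHalts A ∧
    (∃ R, ToricReduction.IsReduction A R) ∧
    ∀ R, ToricReduction.IsReduction A R →
      (ToricReduction.IsCompleteIntersection (ToricReduction.toricIdeal k A) ↔ R = ∅) := by
  refine ⟨ToricReduction.reductionHalts A, ToricReduction.exists_isReduction A, fun R hR => ?_⟩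
  obtain ⟨hrays, hrel⟩ := hR.invariant hA.isSimplicialRays
  rw [hA.isCompleteIntersection_iff k, hrel]
  constructor
  · intro H
    rcases hR.eq_empty_or_forall with h | h
    · exact h
    · by_contra hne
      exact hrays.not_setHasRelations (Finset.nonempty_iff_ne_empty.mpr hne) h H
  · rintro rfl
    exact ToricReduction.setHasRelations_empty _
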